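/- **Setting.** There are $M$ subsystems with states $x_i\in\mathbb R^{n_i}$, inputs $u_i\in\mathbb R^{m_i}$ and neighborhoods $\mathcal N_i\subseteq\{1,\dots,M\}\setminus\{i\}$; the horizon is $N\ge1$. For each $i$ let $\mathcal X_i$ be convex and $\mathcal U_i$ closed and convex, and let $\mathcal X_i=\bigcup_{l=1}^{L_i}P_i^{(l)}$, where the regions $P_i^{(l)}$ are closed convex polyhedra with pairwise disjoint interiors. On region $l$ the update is $$g_i^{(l)}(x_i,u_i,\{x_j\}_{j\in\mathcal N_i})=A_i^{(l)}x_i+B_i^{(l)}u_i+c_i^{(l)}+\sum_{j\in\mathcal N_i}A_{ij}^{(l)}x_j .$$ The dynamics $x_i^+=f_i(x_i,u_i,\{x_j\}_{j\in\mathcal N_i})$ mean that $x_i^+=g_i^{(l)}(x_i,u_i,\{x_j\})$ for some $l$ with $x_i\in P_i^{(l)}$ (several values are possible only on a common boundary of regions). Coupled constraints are $h_i(x_i,\{x_j\}_{j\in\mathcal N_i})\le0$ with $h_i$ affine. Costs are $\ell_i=x_i^\top Q_ix_i+u_i^\top R_iu_i+\sum_{j\in\mathcal N_i}x_j^\top Q_{ij}x_j$,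 $V_{\mathrm f,i}=x_i^\top\Phi_ix_i$ and $F_i=\sum_{k<N}\ell_i(x_i(k),u_i(k),\{x_j^{(i)}(k)\})+V_{\mathrm f,i}(x_i(N))$. Given are gains $K_i^{(l)}$, terminal sets $\mathcal X_{\mathrm T,i}$, $\rho>0$ and $T_{\rm cut}\in\mathbb N$; let $\mathcal X_{\mathrm T}=\prod_i\mathcal X_{\mathrm T,i}$. **Problems.** A local variable $\mathbf y_i=(\tilde{\mathbf x}_i,\mathbf u_i)$ consists of $\tilde{\mathbf x}_i=(\mathbf x_i,(\mathbf x_j^{(i)})_{j\in\mathcal N_i})$, i.e. a trajectory $\mathbf x_i=(x_i(0),\dots,x_i(N))$ and copies $\mathbf x_j^{(i)}$ of the neighbors' trajectories, and of inputs $\mathbf u_i=(u_i(0),\dots,u_i(N-1))$. Let $\mathcal Y_i(x_i)$ be the set of $\mathbf y_i$ with $h_i(x_i(k),\{x_j^{(i)}(k)\})\le0$ and $x_i(k)\in\mathcal X_i$ for $0\le k\le N$, $u_i(k)\in\mathcal U_i$ for $0\le k<N$, $x_i(0)=x_i$ and $x_i(N)\in\mathcal X_{\mathrm T,i}$. For a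 switching sequence $s_i\in\{1,\dots,L_i\}^{N+1}$ let $\mathcal Y_i^{(s_i)}$ be the set of $\mathbf y_i$ with $x_i(k)\in P_i^{(s_i(k))}$ for $0\le k\le N$ and $x_i(k+1)=g_i^{(s_i(k))}(x_i(k),u_i(k),\{x_j^{(i)}(k)\})$ for $0\le k<N$. A family $\mathbf y=(\mathbf y_i)$ is consistent if $\mathbf x_j^{(i)}=\mathbf x_j$ for all $i$ and $j\in\mathcal N_i$. Let $\mathcal Y_s(x)$ be the set of consistent $\mathbf y$ with $\mathbf y_i\in\mathcal Y_i(x_i)\cap\mathcal Y_i^{(s_i)}$ for all $i$, and let $\mathcal Y(x)$, the feasible set of $\mathcal P_{\mathrm d}(x)$, be the set of consistent $\mathbf y$ with $\mathbf y_i\in\mathcal Y_i(x_i)$ and $x_i(k+1)=f_i(x_i(k),u_i(k),\{x_j^{(i)}(k)\})$ for all $i$ and $k<N$. Put $\mathcal X_0=\{x:\mathcal Y(x)\ne\emptyset\}$. **Switching sequences.** $\mathrm{Eval}_i(x_i,\mathbf u_i,\{\mathbf x_j^{(i)}\})$ is the set of all $s_i$ for which some $\xi(0)=x_i,\xi(1),\dots,\xi(N)$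 satisfies $\xi(k)\in\overline{P_i^{(s_i(k))}}$ for all $k$ and $\xi(k+1)=g_i^{(s_i(k))}(\xi(k),u_i(k),\{x_j^{(i)}(k)\})$ for $k<N$. A rollout of $\hat{\mathbf u}$ from $x$ is a consistent $\mathbf y$ with inputs $\hat{\mathbf u}$ and $x_i(0)=x_i$ that obeys the dynamics $f_i$. The guess $\hat{\mathbf u}$ is *weakly feasible* for $x$ if some rollout of it has, with $s_i\in\mathrm{Eval}_i(x_i,\hat{\mathbf u}_i,\{\mathbf x_j^{(i)}\})$ for all $i$, a switching sequence $s$ with $\mathcal Y_s(x)\ne\emptyset$. **Sw-ADMM** at $x$ with guess $\hat{\mathbf u}$ and a rollout of it: start with $\mathbf z^0=0$, $\boldsymbol\lambda^0=0$ and any $s_i\in\mathrm{Eval}_i(x_i,\hat{\mathbf u}_i,\cdot)$ (copies from the rollout). For $\tau=0,1,\dots$: $\mathbf y_i^{\tau+1}$ minimizes $F_i+(\boldsymbol\lambda_i^\tau)^\top\tilde{\mathbf x}_i+\frac\rho2\|\tilde{\mathbf x}_i-\tilde{\mathbf z}_i^\tau\|_2^2$ over $\mathcal Y_i(x_i)\cap\mathcal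 Y_i^{(s_i)}$, where $\tilde{\mathbf z}_i=(\mathbf z_i,(\mathbf z_j)_{j\in\mathcal N_i})$; $\mathbf z_i^{\tau+1}$ is the average of $\mathbf x_i^{\tau+1}$ and of all its copies $\mathbf x_i^{(j),\tau+1}$, $i\in\mathcal N_j$; $\boldsymbol\lambda_i^{\tau+1}=\boldsymbol\lambda_i^\tau+\rho(\tilde{\mathbf x}_i^{\tau+1}-\tilde{\mathbf z}_i^{\tau+1})$; and if $\tau<T_{\rm cut}$ and $\mathrm{Eval}_i(x_i,\mathbf u_i^{\tau+1},\{\mathbf x_j^{(i),\tau+1}\})\setminus\{s_i\}\neq\emptyset$, then $s_i$ is replaced by an element of this set; otherwise $s_i$ is kept. The number of iterations tends to infinity: an output is an accumulation point of $(\mathbf y^\tau)_\tau$ (the limit, if it exists). **Controller** (at each time $t$, with state $x$). If $x\in\mathcal X_{\mathrm T}$, apply $u_i=K_i^{(l)}x_i$ for some $l$ with $x_i\in P_i^{(l)}$. Otherwise take a guess $\hat{\mathbf u}$: at $t=0$ a given one, at $t>0$ the sequences $\hat{\mathbf u}_i=(\bar u_i(1),\dots,\bar u_i(N-1),K_i^{(l)}\bar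 x_i(N))$ with $\bar x_i(N)\in P_i^{(l)}$, where $(\bar{\mathbf x},\bar{\mathbf u})$ is the last stored solution. Compute a rollout $\mathbf y_{\rm dr}$ of $\hat{\mathbf u}$ and an output $\mathbf y$ of Sw-ADMM; let $F_{i,\rm dr}=F_i(\mathbf y_{i,\rm dr})$ if $\mathbf y_{\rm dr}\in\mathcal Y(x)$, and $F_{i,\rm dr}=\infty$ for all $i$ otherwise. If $F_i(\mathbf y_i)\le F_{i,\rm dr}$ fails for some $i$, replace $\mathbf y$ by $\mathbf y_{\rm dr}$. Store $\mathbf y$ and apply $u_i(0)$. The next state satisfies $x_i^+=f_i(x_i,u_i,\{x_j\}_{j\in\mathcal N_i})$. **Assumptions.** Write $\hat{\mathcal L}_i=\{l:0\in\overline{P_i^{(l)}}\}$. 1. For every $x\in\mathcal X_0$ there is no $s$ with $\mathcal Y_s(x)=\emptyset$ and $\mathcal Y_i(x_i)\cap\mathcal Y_i^{(s_i)}\ne\emptyset$ for all $i$. 2. The number of ADMM iterations tends to infinity, as described above. 3. All pairs $(A_i^{(l)},B_i^{(l)})$ are controllable, all $A_i^{(l)}+B_i^{(l)}K_i^{(l)}$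 are Schur, and $c_i^{(l)}=0$ for $l\in\hat{\mathcal L}_i$. 4. Each $\mathcal X_{\mathrm T,i}\subseteq\bigcup_{l\in\hat{\mathcal L}_i}P_i^{(l)}$ is closed and convex and contains $0$; for $x_i\in\mathcal X_{\mathrm T,i}\cap P_i^{(l)}$ and $x_j\in\mathcal X_{\mathrm T,j}$ ($j\in\mathcal N_i$) one has $K_i^{(l)}x_i\in\mathcal U_i$ and $g_i^{(l)}(x_i,K_i^{(l)}x_i,\{x_j\})\in\mathcal X_{\mathrm T,i}$; and $h_i(x_i,\{x_j\})\le0$ for all $x\in\mathcal X_{\mathrm T}$ and all $i$. 5. $Q_i,R_i,\Phi_i$ are positive definite and $Q_{ij}$ positive semidefinite, and $\sum_i\big(V_{\mathrm f,i}(x_i^+)-V_{\mathrm f,i}(x_i)+\ell_i(x_i,u_i,\{x_j\})\big)\le0$ for all $x\in\mathcal X_{\mathrm T}$ and all $l_i$ with $x_i\in P_i^{(l_i)}$, where $u_i=K_i^{(l_i)}x_i$ and $x_i^+=g_i^{(l_i)}(x_i,u_i,\{x_j\})$. 6. The guess at $t=0$ is weakly feasible for the initial state. **Theorem.** Let Assumptions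 1–6 hold, let $x(0)\in\mathcal X_0\setminus\mathcal X_{\mathrm T}$, and let $x(0),x(1),\dots,x(T)$, $T\ge 0$ arbitrary, be states of the closed loop under the controller above, such that the state update is unambiguous along it (if $x_i(t)$, $t<T$, lies in several regions, their updates agree at $x(t)$ and the applied input). Then for every $t\le T$ with $x(t)\notin\mathcal X_{\mathrm T}$ the problem $\mathcal P_{\mathrm d}(x(t))$ is feasible, i.e. $\mathcal Y(x(t))\neq\emptyset$. Moreover, at each such $t$ every infinite sequence of Sw-ADMM iterates at $x(t)$ has an accumulation point. -/

import Mathlib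

open Matrix Filter Topology

/-- A closed convex polyhedron: a finite intersection of closed half-spaces. -/
def IsPolyhedron {d : ℕ} (P : Set (Fin d → ℝ)) : Prop :=
  ∃ (r : ℕ) (a : Fin r → Fin d → ℝ) (b : Fin r → ℝ), P = {x | ∀ e, a e ⬝ᵥ x ≤ b e}

/-- Controllability of a pair `(A, B)`: the columns of `B, A B, …, A ^ (d - 1) B` span the state
space. -/
def IsControllablePair {d p : ℕ} (A : Matrix (Fin d) (Fin d) ℝ) (B : Matrix (Fin d) (Fin p) ℝ) :
    Prop :=
  (⨆ k : Fin d, LinearMap.range (A ^ (k : ℕ) * B).mulVecLin) = ⊤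

/-- A real square matrix is Schur if all its complex eigenvalues lie in the open unit disc. -/
def IsSchurMatrix {d : ℕ} (A : Matrix (Fin d) (Fin d) ℝ) : Prop :=
  ∀ μ ∈ spectrum ℂ (A.map (fun r : ℝ => (r : ℂ))), ‖μ‖ < 1

/-- The data of a network of coupled piecewise affine subsystems, of the model predictive
controller and of the switching ADMM procedure. -/
structure PWANetwork where
  /-- number of subsystems -/
  M : ℕ
  /-- state dimensions -/
  n : Fin M → ℕ
  /-- input dimensions -/
  m : Fin M → ℕ
  /-- neighborhoods: `j ∈ nbr i` if subsystem `j` affects subsystem `i` -/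
  nbr : Fin M → Finset (Fin M)
  /-- local state constraint sets -/
  X : ∀ i, Set (Fin (n i) → ℝ)
  /-- local input constraint sets -/
  U : ∀ i, Set (Fin (m i) → ℝ)
  /-- numbers of regions -/
  L : Fin M → ℕ
  /-- regions -/
  P : ∀ i, Fin (L i) → Set (Fin (n i) → ℝ)
  A : ∀ i, Fin (L i) → Matrix (Fin (n i)) (Fin (n i)) ℝ
  B : ∀ i, Fin (L i) → Matrix (Fin (n i)) (Fin (m i)) ℝ
  c : ∀ i, Fin (L i) → Fin (n i) → ℝ
  /-- coupling matrices; only those with `j ∈ nbr i` are used -/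
  Ac : ∀ i j, Fin (L i) → Matrix (Fin (n i)) (Fin (n j)) ℝ
  /-- numbers of rows of the coupled inequality constraints -/
  q : Fin M → ℕ
  H : ∀ i, Matrix (Fin (q i)) (Fin (n i)) ℝ
  Hc : ∀ i j, Matrix (Fin (q i)) (Fin (n j)) ℝ
  b : ∀ i, Fin (q i) → ℝ
  /-- prediction horizon -/
  N : ℕ
  /-- cost matrices -/
  Q : ∀ i, Matrix (Fin (n i)) (Fin (n i)) ℝ
  R : ∀ i, Matrix (Fin (m i)) (Fin (m i)) ℝ
  Qc : Fin M → ∀ j, Matrix (Fin (n j)) (Fin (n j)) ℝ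
  Phi : ∀ i, Matrix (Fin (n i)) (Fin (n i)) ℝ
  /-- terminal gains -/
  K : ∀ i, Fin (L i) → Matrix (Fin (m i)) (Fin (n i)) ℝ
  /-- local terminal sets -/
  XT : ∀ i, Set (Fin (n i) → ℝ)
  /-- ADMM penalty parameter -/
  rho : ℝ
  /-- number of ADMM iterations after which the switching sequences are frozen -/
  Tcut : ℕ

namespace PWANetwork

variable (S : PWANetwork)

/-! ### Variables -/

/-- The neighbors of subsystem `i`. -/
abbrev Nb (i : Fin S.M) : Type := {j : Fin S.M // j ∈ S.nbr i}

/-- Global states. -/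
abbrev State : Type := ∀ i, Fin (S.n i) → ℝ

/-- Global inputs. -/
abbrev Input : Type := ∀ i, Fin (S.m i) → ℝ

/-- State trajectories of subsystem `i` over the times `0, …, N`. -/
abbrev Traj (i : Fin S.M) : Type := Fin (S.N + 1) → Fin (S.n i) → ℝ

/-- Input sequences of subsystem `i` over the times `0, …, N - 1`. -/
abbrev InputSeq (i : Fin S.M) : Type := Fin S.N → Fin (S.m i) → ℝ

/-- Augmented trajectories: own trajectory and copies of the trajectories of the neighbors. -/
abbrev AugTraj (i : Fin S.M) : Type := S.Traj i × (∀ j : S.Nb i, S.Traj j)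

/-- Local decision variables: augmented trajectory and input sequence. -/
abbrev LocalVar (i : Fin S.M) : Type := S.AugTraj i × S.InputSeq i

/-- Global decision variables. -/
abbrev Var : Type := ∀ i, S.LocalVar i

/-- Local switching sequences over the times `0, …, N`. -/
abbrev Switching (i : Fin S.M) : Type := Fin (S.N + 1) → Fin (S.L i)

variable {S}

/-- The own trajectory in a local variable. -/
abbrev own {i : Fin S.M} (y : S.LocalVar i) : S.Traj i := y.1.1

/-- The copy of the trajectory of the neighbor `j` in a local variable. -/
abbrev copy {i : Fin S.M} (y : S.LocalVar i) (j : S.Nb i) : S.Traj j := y.1.2 j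

/-- The input sequence in a local variable. -/
abbrev inp {i : Fin S.M} (y : S.LocalVar i) : S.InputSeq i := y.2

variable (S)

/-! ### Dynamics -/

/-- The affine state update of subsystem `i` attached to its region `l`. -/
def piece (i : Fin S.M) (l : Fin (S.L i)) (xi : Fin (S.n i) → ℝ) (ui : Fin (S.m i) → ℝ)
    (xj : ∀ j : S.Nb i, Fin (S.n j) → ℝ) : Fin (S.n i) → ℝ :=
  S.A i l *ᵥ xi + S.B i l *ᵥ ui + S.c i l + ∑ j : S.Nb i, S.Ac i j l *ᵥ xj j

/-- The piecewise affine dynamics: `xi'` is a successor of `xi` if it is given by the state update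
of a region that contains `xi`. On a common boundary of several regions each of their updates is
a successor. -/
def Next (i : Fin S.M) (xi : Fin (S.n i) → ℝ) (ui : Fin (S.m i) → ℝ)
    (xj : ∀ j : S.Nb i, Fin (S.n j) → ℝ) (xi' : Fin (S.n i) → ℝ) : Prop :=
  ∃ l, xi ∈ S.P i l ∧ xi' = S.piece i l xi ui xj

/-- The coupled inequality constraint `h_i ≤ 0`. -/
def Coupled (i : Fin S.M) (xi : Fin (S.n i) → ℝ) (xj : ∀ j : S.Nb i, Fin (S.n j) → ℝ) : Prop :=
  S.H i *ᵥ xi + ∑ j : S.Nb i, S.Hc i j *ᵥ xj j ≤ S.b i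

/-! ### Costs -/

/-- Stage cost. -/
def stageCost (i : Fin S.M) (xi : Fin (S.n i) → ℝ) (ui : Fin (S.m i) → ℝ)
    (xj : ∀ j : S.Nb i, Fin (S.n j) → ℝ) : ℝ :=
  xi ⬝ᵥ (S.Q i *ᵥ xi) + ui ⬝ᵥ (S.R i *ᵥ ui) + ∑ j : S.Nb i, xj j ⬝ᵥ (S.Qc i j *ᵥ xj j)

/-- Terminal cost. -/
def termCost (i : Fin S.M) (xi : Fin (S.n i) → ℝ) : ℝ := xi ⬝ᵥ (S.Phi i *ᵥ xi)

/-- The local cost `F_i`. -/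
def cost (i : Fin S.M) (y : S.LocalVar i) : ℝ :=
  (∑ k : Fin S.N, S.stageCost i (own y k.castSucc) (inp y k) (fun j => copy y j k.castSucc))
    + S.termCost i (own y (Fin.last S.N))

/-! ### Feasible sets, with terminal constraints -/

/-- The global terminal set. -/
def terminalSet : Set S.State := {x | ∀ i, x i ∈ S.XT i}

/-- The local constraints that do not depend on a switching sequence. -/
def localSet (i : Fin S.M) (xi : Fin (S.n i) → ℝ) : Set (S.LocalVar i) :=
  {y | (∀ k, S.Coupled i (own y k) (fun j => copy y j k)) ∧
       (∀ k, own y k ∈ S.X i) ∧ (∀ k, inp y k ∈ S.U i) ∧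
       own y 0 = xi ∧ own y (Fin.last S.N) ∈ S.XT i}

/-- The local constraints that depend on the switching sequence. -/
def switchSet (i : Fin S.M) (s : S.Switching i) : Set (S.LocalVar i) :=
  {y | (∀ k : Fin S.N, own y k.succ =
          S.piece i (s k.castSucc) (own y k.castSucc) (inp y k) (fun j => copy y j k.castSucc)) ∧
       (∀ k, own y k ∈ S.P i (s k))}

/-- Consistency between the trajectories and their copies. -/
def Consistent (y : S.Var) : Prop :=
  ∀ (i : Fin S.M) (j : S.Nb i), copy (y i) j = own (y j)

/-- The feasible set of the distributed problem `P_d(x)`. -/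
def feasibleSet (x : S.State) : Set S.Var :=
  {y | (∀ i, y i ∈ S.localSet i (x i)) ∧
       (∀ (i : Fin S.M) (k : Fin S.N), S.Next i (own (y i) k.castSucc) (inp (y i) k)
          (fun j => copy (y i) j k.castSucc) (own (y i) k.succ)) ∧
       S.Consistent y}

/-- The feasible set of the problem `P_s(x)` for a global switching sequence `s`. -/
def feasibleSetOf (s : ∀ i, S.Switching i) (x : S.State) : Set S.Var :=
  {y | (∀ i, y i ∈ S.localSet i (x i) ∩ S.switchSet i (s i)) ∧ S.Consistent y}

/-- The set `X_0` of states for which `P_d(x)` is feasible. -/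
def feasibleStates : Set S.State := {x | (S.feasibleSet x).Nonempty}

/-! ### Rollouts and generated switching sequences -/

/-- `y` is a rollout of the input sequences `v` along the network dynamics from the state `x`
(distributed rollout: the copies are the transmitted true states). -/
def IsRollout (x : S.State) (v : ∀ i, S.InputSeq i) (y : S.Var) : Prop :=
  (∀ i, inp (y i) = v i) ∧ (∀ i, own (y i) 0 = x i) ∧ S.Consistent y ∧
  ∀ (i : Fin S.M) (k : Fin S.N), S.Next i (own (y i) k.castSucc) (inp (y i) k)
    (fun j => copy (y i) j k.castSucc) (own (y i) k.succ)

/-- The switching sequences that subsystem `i` generates by rolling out and branching its dynamics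
from `xi` under given inputs and given copies of the trajectories of its neighbors. -/
def evalSwitching (i : Fin S.M) (xi : Fin (S.n i) → ℝ) (ui : S.InputSeq i)
    (xj : ∀ j : S.Nb i, S.Traj j) : Set (S.Switching i) :=
  {s | ∃ ξ : S.Traj i, ξ 0 = xi ∧ (∀ k, ξ k ∈ closure (S.P i (s k))) ∧
        ∀ k : Fin S.N, ξ k.succ =
          S.piece i (s k.castSucc) (ξ k.castSucc) (ui k) (fun j => xj j k.castSucc)}

/-- The input sequences `v` are weakly feasible for `x`: the rollout of `v` generates a global
switching sequence `s` for which `P_s(x)` is feasible. -/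
def WeaklyFeasible (x : S.State) (v : ∀ i, S.InputSeq i) : Prop :=
  ∃ y, S.IsRollout x v y ∧ ∃ s : ∀ i, S.Switching i,
    (∀ i, s i ∈ S.evalSwitching i (x i) (v i) (copy (y i))) ∧ (S.feasibleSetOf s x).Nonempty

/-! ### Switching ADMM -/

/-- Euclidean inner product of augmented trajectories. -/
def augInner {i : Fin S.M} (v w : S.AugTraj i) : ℝ :=
  (∑ k, v.1 k ⬝ᵥ w.1 k) + ∑ j : S.Nb i, ∑ k, v.2 j k ⬝ᵥ w.2 j k

/-- The components of `z` that are relevant for subsystem `i`. -/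
def augOf (z : ∀ i, S.Traj i) (i : Fin S.M) : S.AugTraj i := (z i, fun j => z j)

/-- The objective of the local minimization: local cost, multiplier term and penalty. -/
noncomputable def augLagrangian (i : Fin S.M) (lam zi : S.AugTraj i) (y : S.LocalVar i) : ℝ :=
  S.cost i y + S.augInner lam y.1 + S.rho / 2 * S.augInner (y.1 - zi) (y.1 - zi)

/-- The average of the trajectory of subsystem `i` and of all copies of it. The copies are held by
the subsystems `j` with `i ∈ nbr j`. -/
noncomputable def average (y : S.Var) (i : Fin S.M) : S.Traj i :=
  ((Fintype.card {j : Fin S.M // i ∈ S.nbr j} : ℝ) + 1)⁻¹ •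
    (own (y i) + ∑ j : {j : Fin S.M // i ∈ S.nbr j}, copy (y j) ⟨i, j.2⟩)

/-- `(s, y, z, lam)` are the iterates of the switching ADMM procedure, run without a bound on the
number of iterations, at the state `x` with initial guess `v` and initial copies taken from
`ydr`. The value `y 0` is not used. -/
structure IsSwADMM (x : S.State) (v : ∀ i, S.InputSeq i) (ydr : S.Var)
    (s : ℕ → ∀ i, S.Switching i) (y : ℕ → S.Var) (z : ℕ → ∀ i, S.Traj i)
    (lam : ℕ → ∀ i, S.AugTraj i) : Prop where
  z_zero : z 0 = 0
  lam_zero : lam 0 = 0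
  s_zero : ∀ i, s 0 i ∈ S.evalSwitching i (x i) (v i) (copy (ydr i))
  y_mem : ∀ τ i, y (τ + 1) i ∈ S.localSet i (x i) ∩ S.switchSet i (s τ i)
  y_min : ∀ τ i, ∀ w ∈ S.localSet i (x i) ∩ S.switchSet i (s τ i),
    S.augLagrangian i (lam τ i) (S.augOf (z τ) i) (y (τ + 1) i) ≤
      S.augLagrangian i (lam τ i) (S.augOf (z τ) i) w
  z_succ : ∀ τ i, z (τ + 1) i = S.average (y (τ + 1)) i
  lam_succ : ∀ τ i,
    lam (τ + 1) i = lam τ i + S.rho • ((y (τ + 1) i).1 - S.augOf (z (τ + 1)) i)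
  s_switch : ∀ τ < S.Tcut, ∀ i,
    (S.evalSwitching i (x i) (inp (y (τ + 1) i)) (copy (y (τ + 1) i)) \ {s τ i}).Nonempty →
      s (τ + 1) i ∈
        S.evalSwitching i (x i) (inp (y (τ + 1) i)) (copy (y (τ + 1) i)) \ {s τ i}
  s_keep : ∀ τ < S.Tcut, ∀ i,
    ¬ (S.evalSwitching i (x i) (inp (y (τ + 1) i)) (copy (y (τ + 1) i)) \ {s τ i}).Nonempty →
      s (τ + 1) i = s τ i
  s_frozen : ∀ τ, S.Tcut ≤ τ → s (τ + 1) = s τ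

/-- `yout` is an output of the switching ADMM procedure when the number of iterations tends to
infinity: an accumulation point of the iterates (their limit, if they converge). -/
def IsSwADMMOutput (x : S.State) (v : ∀ i, S.InputSeq i) (ydr yout : S.Var) : Prop :=
  ∃ s y z lam, S.IsSwADMM x v ydr s y z lam ∧ MapClusterPt yout atTop y

/-! ### The stabilizing distributed controller -/

open Classical in
/-- The cost of subsystem `i` in a rollout `ydr`, with the convention that the value of a rollout
that violates a constraint of `P_d(x)` is infinite. -/
noncomputable def rolloutCost (x : S.State) (ydr : S.Var) (i : Fin S.M) : EReal :=
  if ydr ∈ S.feasibleSet x then ((S.cost i (ydr i) : ℝ) : EReal) else ⊤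

/-- One optimization step at the state `x` with the guess `v`: roll out the guess, run the
switching ADMM procedure, and fall back to the rollout if the result does not improve on it. -/
def OptStep (x : S.State) (v : ∀ i, S.InputSeq i) (y : S.Var) : Prop :=
  ∃ ydr yout, S.IsRollout x v ydr ∧ S.IsSwADMMOutput x v ydr yout ∧
    ((∀ i, ((S.cost i (yout i) : ℝ) : EReal) ≤ S.rolloutCost x ydr i) → y = yout) ∧
    (¬ (∀ i, ((S.cost i (yout i) : ℝ) : EReal) ≤ S.rolloutCost x ydr i) → y = ydr)

/-- `v` is the previous solution `y`, shifted by one time step, with the terminal controller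
appended. -/
def IsShiftedGuess (y : S.Var) (v : ∀ i, S.InputSeq i) : Prop :=
  ∀ i, ∃ l, own (y i) (Fin.last S.N) ∈ S.P i l ∧ ∀ k : Fin S.N,
    v i k = if h : (k : ℕ) + 1 < S.N then inp (y i) ⟨(k : ℕ) + 1, h⟩
      else S.K i l *ᵥ own (y i) (Fin.last S.N)

/-- The closed loop over the time steps `0, …, T - 1`: states `x`, guesses `v`, stored solutions
`y` and applied inputs `u`. The guess `v 0` of the first time step is given from outside. -/
structure IsClosedLoop (T : ℕ) (x : ℕ → S.State) (v : ℕ → ∀ i, S.InputSeq i) (y : ℕ → S.Var)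
    (u : ℕ → S.Input) : Prop where
  /-- inside the terminal set the terminal controllers are applied -/
  terminal : ∀ t < T, x t ∈ S.terminalSet →
    ∀ i, ∃ l, x t i ∈ S.P i l ∧ u t i = S.K i l *ᵥ x t i
  /-- and the stored solution is left unchanged -/
  stored : ∀ t, t + 1 < T → x (t + 1) ∈ S.terminalSet → y (t + 1) = y t
  guess : ∀ t, t + 1 < T → x (t + 1) ∉ S.terminalSet → S.IsShiftedGuess (y t) (v (t + 1))
  optimize : ∀ t < T, x t ∉ S.terminalSet → S.OptStep (x t) (v t) (y t)
  apply_first : ∀ t < T, x t ∉ S.terminalSet →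
    ∀ i (h : 0 < S.N), u t i = inp (y t i) ⟨0, h⟩
  plant : ∀ t < T, ∀ i, S.Next i (x t i) (u t i) (fun j => x t j) (x (t + 1) i)

/-- The state update of the network is unambiguous at the state `x` under the input `u`: if a local
state lies in several regions, then their state updates agree there. -/
def UnambiguousAt (x : S.State) (u : S.Input) : Prop :=
  ∀ i l l', x i ∈ S.P i l → x i ∈ S.P i l' →
    S.piece i l (x i) (u i) (fun j => x j) = S.piece i l' (x i) (u i) (fun j => x j)

/-! ### Assumptions -/

/-- Standing assumptions on the network, the horizon and the penalty parameter. -/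
structure Standing : Prop where
  nbr_irrefl : ∀ i, i ∉ S.nbr i
  X_convex : ∀ i, Convex ℝ (S.X i)
  U_convex : ∀ i, Convex ℝ (S.U i)
  U_closed : ∀ i, IsClosed (S.U i)
  P_polyhedron : ∀ i l, IsPolyhedron (S.P i l)
  P_interior : ∀ i l l', l ≠ l' → interior (S.P i l) ∩ interior (S.P i l') = ∅
  P_cover : ∀ i, (⋃ l, S.P i l) = S.X i
  N_pos : 0 < S.N
  rho_pos : 0 < S.rho

/-- No global switching sequence has an infeasible problem `P_s(x)` although all its local
constraint sets are non-empty. -/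
def SwitchingAssumption : Prop :=
  ∀ x ∈ S.feasibleStates, ¬ ∃ s : ∀ i, S.Switching i,
    S.feasibleSetOf s x = ∅ ∧ ∀ i, (S.localSet i (x i) ∩ S.switchSet i (s i)).Nonempty

/-- The regions of subsystem `i` that contain or touch the origin. -/
def originRegions (i : Fin S.M) : Set (Fin (S.L i)) := {l | (0 : Fin (S.n i) → ℝ) ∈ closure (S.P i l)}

/-- Controllability with stabilizing gains, and the origin is an equilibrium. -/
structure SystemAssumption : Prop where
  controllable : ∀ i l, IsControllablePair (S.A i l) (S.B i l)
  schur : ∀ i l, IsSchurMatrix (S.A i l + S.B i l * S.K i l)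
  equilibrium : ∀ i, ∀ l ∈ S.originRegions i, S.c i l = 0

/-- The local terminal sets are closed convex sets around the origin, invariant under the terminal
controllers whenever the neighbors are in their terminal sets, and compatible with the
constraints. -/
structure TerminalAssumption : Prop where
  closed : ∀ i, IsClosed (S.XT i)
  convex : ∀ i, Convex ℝ (S.XT i)
  zero_mem : ∀ i, (0 : Fin (S.n i) → ℝ) ∈ S.XT i
  subset : ∀ i, S.XT i ⊆ ⋃ l ∈ S.originRegions i, S.P i l
  input_mem : ∀ i, ∀ xi ∈ S.XT i, ∀ l, xi ∈ S.P i l → S.K i l *ᵥ xi ∈ S.U i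
  invariant : ∀ i, ∀ xi ∈ S.XT i, ∀ xj : ∀ j : S.Nb i, Fin (S.n j) → ℝ,
    (∀ j : S.Nb i, xj j ∈ S.XT j) → ∀ l, xi ∈ S.P i l →
      S.piece i l xi (S.K i l *ᵥ xi) xj ∈ S.XT i
  coupled : ∀ x ∈ S.terminalSet, ∀ i, S.Coupled i (x i) (fun j => x j)

/-- Convex quadratic costs, and decrease of the terminal cost on the terminal set. -/
structure LyapunovAssumption : Prop where
  Q_posDef : ∀ i, (S.Q i).PosDef
  R_posDef : ∀ i, (S.R i).PosDef
  Phi_posDef : ∀ i, (S.Phi i).PosDef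
  Qc_posSemidef : ∀ i, ∀ j ∈ S.nbr i, (S.Qc i j).PosSemidef
  decrease : ∀ x ∈ S.terminalSet, ∀ l : ∀ i, Fin (S.L i), (∀ i, x i ∈ S.P i (l i)) →
    ∑ i, (S.termCost i (S.piece i (l i) (x i) (S.K i (l i) *ᵥ x i) (fun j => x j))
      - S.termCost i (x i)
      + S.stageCost i (x i) (S.K i (l i) *ᵥ x i) (fun j => x j)) ≤ 0

end PWANetwork

/-! The invariant along the closed loop is that the state lies in the terminal set, which the
terminal gains keep invariant, or in `feasibleStates` (`IsClosedLoop.terminal_or_feasible`). Outside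
the terminal set it suffices that the stored solution is feasible: `mem_feasibleStates_of_shift`
then produces a feasible solution at the successor, and unambiguity ensures that plant and plan
share this successor.

The stored solution is a feasible rollout or an output of the switching ADMM. From `Tcut` on the
switching sequence is frozen. Every local set contains an iterate, so the switching assumption makes
the frozen global problem feasible, and the remaining iteration is consensus ADMM for a quadratic
cost over closed convex sets. Its accumulation points satisfy the local constraints by closedness;
they are consistent once the consensus residual tends to zero, and they exist once the iterates are
bounded.

Both facts come from `consensusADMM_bounded_and_residual_tendsto`. The multipliers may be unbounded,
so there is no comparison with a saddle point. The energy "squared residual plus squared change of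
the consensus part" decreases, with a loss proportional to its second term because cost and squared
residual together are coercive. The Lagrangian value without penalty grows by a multiple of the
squared residual, up to terms paid for by that loss, while comparison with a feasible point bounds
it from above. Hence the residuals vanish, and the same bound controls the distance to the feasible
point. -/

/-- A Lyapunov argument for real sequences: an antitone energy `a + b` with dissipation `α * b` and
an almost monotone, bounded above sequence `φ`. -/
theorem bounded_and_tendsto_zero_of_dissipation {a b φ e : ℕ → ℝ} {α ρ K₀ K₁ : ℝ}
    (ha : ∀ n, 0 ≤ a n) (hb : ∀ n, 0 ≤ b n) (he : ∀ n, 0 ≤ e n)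
    (hα : 0 < α) (hρ : 0 < ρ) (hK₁ : 0 ≤ K₁)
    (hdiss : ∀ n, a (n + 1) + b (n + 1) + α * b (n + 1) ≤ a n + b n)
    (hincr : ∀ n, φ n + ρ * a (n + 1) - ρ / 2 * (b n + b (n + 1)) ≤ φ (n + 1))
    (hupper : ∀ n, φ n ≤ K₀ - e n / 2 + K₁ * (a n + b n)) :
    (∃ K, ∀ n, e n ≤ K) ∧ Tendsto a atTop (𝓝 0) := by
  have hanti : Antitone fun n => a n + b n := antitone_nat_of_succ_le fun n => by
    nlinarith [hdiss n, mul_nonneg hα.le (hb (n + 1))]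
  have hD : ∀ n, a n + b n ≤ a 0 + b 0 := fun n => hanti (Nat.zero_le n)
  -- The weight `ρ / α` turns the dissipation into a gain `ρ * b (n + 1)`; the last term shifts half
  -- of it back one index, so that both errors in `hincr` cancel exactly.
  set ψ : ℕ → ℝ := fun n => φ n - ρ / α * (a n + b n) - ρ / 2 * b n with hψ
  have hstep : ∀ n, ψ n + ρ * a (n + 1) ≤ ψ (n + 1) := fun n => by
    have h := mul_le_mul_of_nonneg_left (hdiss n) (div_pos hρ hα).le
    have h' : ρ / α * (α * b (n + 1)) = ρ * b (n + 1) := by field_simp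
    simp only [hψ]
    linarith [hincr n, h, h']
  have hmono : Monotone ψ := monotone_nat_of_le_succ fun n => by
    linarith [hstep n, mul_nonneg hρ.le (ha (n + 1))]
  have hψφ : ∀ n, ψ n ≤ φ n := fun n => by
    have h₁ := mul_nonneg (div_pos hρ hα).le (add_nonneg (ha n) (hb n))
    have h₂ := mul_nonneg hρ.le (hb n)
    simp only [hψ]
    linarith
  have hφ : ∀ n, φ n ≤ K₀ - e n / 2 + K₁ * (a 0 + b 0) := fun n => by
    linarith [hupper n, mul_le_mul_of_nonneg_left (hD n) hK₁]
  refine ⟨⟨2 * (K₀ + K₁ * (a 0 + b 0) - ψ 0), fun n => ?_⟩, ?_⟩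
  · linarith [hφ n, hψφ n, hmono (Nat.zero_le n)]
  · have hbdd : BddAbove (Set.range ψ) := ⟨K₀ + K₁ * (a 0 + b 0), by
      rintro _ ⟨n, rfl⟩
      linarith [hφ n, hψφ n, he n]⟩
    have hlim := tendsto_atTop_ciSup hmono hbdd
    have hdiff : Tendsto (fun n => ρ⁻¹ * (ψ (n + 1) - ψ n)) atTop (𝓝 0) := by
      simpa using ((hlim.comp (tendsto_add_atTop_nat 1)).sub hlim).const_mul ρ⁻¹
    refine (tendsto_add_atTop_iff_nat 1).1 (squeeze_zero (fun n => ha _) (fun n => ?_) hdiff)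
    rw [inv_mul_eq_div, le_div_iff₀ hρ]
    linarith [hstep n]

/-- If `l + t * c` is nonnegative for all small positive `t`, then so is `l`. -/
theorem nonneg_of_forall_add_mul_nonneg {l c : ℝ} (h : ∀ t, 0 < t → t ≤ 1 → 0 ≤ l + t * c) :
    0 ≤ l := by
  have hlim : Tendsto (fun t : ℝ => l + t * c) (𝓝[>] 0) (𝓝 l) := by
    have : Tendsto (fun t : ℝ => l + t * c) (𝓝 0) (𝓝 (l + 0 * c)) :=
      (continuous_const.add (continuous_id.mul continuous_const)).tendsto 0
    simpa using this.mono_left nhdsWithin_le_nhds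
  refine ge_of_tendsto hlim ?_
  filter_upwards [Ioc_mem_nhdsGT (zero_lt_one' ℝ)] with t ht using h t ht.1 ht.2

/-! ### Consensus ADMM in an abstract bilinear setting. -/

section ConsensusADMM

variable {V E : Type*} [AddCommGroup V] [Module ℝ V] [AddCommGroup E] [Module ℝ E]

/-- Quadratic growth at a minimizer of an augmented Lagrangian over a convex set. -/
theorem augmentedLagrangian_growth {B : LinearMap.BilinForm ℝ E} (hsymm : ∀ a b, B a b = B b a)
    {π : V →ₗ[ℝ] E} {F : V → ℝ}
    (hF : ∀ a b : V, ∀ t : ℝ,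
      F (a + t • (b - a)) = (1 - t) * F a + t * F b - t * (1 - t) * F (b - a))
    {C : Set V} (hC : Convex ℝ C) {ρ : ℝ} {lam ζ : E} {y w : V} (hy : y ∈ C) (hw : w ∈ C)
    (hmin : ∀ w ∈ C, F y + B lam (π y) + ρ / 2 * B (π y - ζ) (π y - ζ) ≤
      F w + B lam (π w) + ρ / 2 * B (π w - ζ) (π w - ζ)) :
    F y + F (w - y) ≤ F w + B (lam + ρ • (π y - ζ)) (π (w - y)) := by
  -- This is the directional derivative at `y` towards `w`. The increment along the segment is
  -- exactly `t * (l + t * c)`, so no differentiability is needed.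
  suffices 0 ≤ F w - F y - F (w - y) + B (lam + ρ • (π y - ζ)) (π (w - y)) by linarith
  apply nonneg_of_forall_add_mul_nonneg
    (c := F (w - y) + ρ / 2 * B (π (w - y)) (π (w - y)))
  intro t ht ht1
  have hmem : y + t • (w - y) ∈ C := hC.add_smul_sub_mem hy hw ⟨ht.le, ht1⟩
  have h := hmin _ hmem
  have hs : π (y + t • (w - y)) - ζ = (π y - ζ) + t • π (w - y) := by
    rw [map_add, map_smul]; abel
  rw [hF, hs, map_add π y, map_smul π t] at h
  set d := π (w - y)
  set q := π y - ζ
  have hsym := hsymm d q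
  simp only [map_add, map_smul, LinearMap.add_apply, LinearMap.smul_apply, smul_eq_mul] at h ⊢
  rw [hsym] at h
  refine nonneg_of_mul_nonneg_right (a := t) ?_ ht
  nlinarith [h]

/-- Consensus ADMM with a feasible point: `p` and `r` are the consensus part and the
residual of the coupled variables. The costs of the differences to the feasible point stay bounded
and the residuals tend to zero. No dual solution is required. -/
theorem consensusADMM_bounded_and_residual_tendsto
    {B : LinearMap.BilinForm ℝ E} (hsymm : ∀ a b, B a b = B b a) (hpos : ∀ a, 0 ≤ B a a)
    {p r : V →ₗ[ℝ] E} (horth : ∀ y y', B (r y) (p y') = 0)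
    {F : V → ℝ} (hF₀ : ∀ y, 0 ≤ F y)
    (hF : ∀ a b : V, ∀ t : ℝ,
      F (a + t • (b - a)) = (1 - t) * F a + t * F b - t * (1 - t) * F (b - a))
    {c : ℝ} (hc : 0 < c) (hcoer : ∀ y, B (p y) (p y) ≤ c * (F y + B (r y) (r y)))
    {C : Set V} (hC : Convex ℝ C) {ρ : ℝ} (hρ : 0 < ρ) {y : ℕ → V} {lam : ℕ → E}
    (hlam₀ : ∀ d, B (lam 0) (p d) = 0)
    (hlam : ∀ n, lam (n + 1) = lam n + ρ • r (y (n + 1)))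
    (hmem : ∀ n, y n ∈ C)
    (hmin : ∀ n, ∀ w ∈ C,
      F (y (n + 1)) + B (lam n) ((p + r) (y (n + 1))) +
          ρ / 2 * B ((p + r) (y (n + 1)) - p (y n)) ((p + r) (y (n + 1)) - p (y n)) ≤
        F w + B (lam n) ((p + r) w) + ρ / 2 * B ((p + r) w - p (y n)) ((p + r) w - p (y n)))
    {y' : V} (hy' : y' ∈ C) (hr' : r y' = 0) :
    (∃ K, ∀ n, F (y' - y n) ≤ K) ∧ Tendsto (fun n => B (r (y n)) (r (y n))) atTop (𝓝 0) := by
  -- Multipliers only accumulate residuals, hence stay orthogonal to the consensus parts.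
  have hlamp : ∀ n d, B (lam n) (p d) = 0 := by
    intro n
    induction n with
    | zero => exact hlam₀
    | succ n ih =>
      intro d
      rw [hlam]
      simp [ih d, horth]
  have horth' : ∀ u w, B (p u) (r w) = 0 := fun u w => by rw [hsymm, horth]
  -- The effective multiplier at the new iterate is `lam (n + 1) + ρ • p (y (n + 1) - y n)`;
  -- orthogonality removes the mixed products.
  have hgrow : ∀ n, ∀ w ∈ C, F (y (n + 1)) + F (w - y (n + 1)) ≤ F w
      + B (lam (n + 1)) (r (w - y (n + 1)))
      + ρ * B (p (y (n + 1) - y n)) (p (w - y (n + 1))) := by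
    intro n w hw
    have h := augmentedLagrangian_growth hsymm hF hC (hmem (n + 1)) hw (hmin n)
    have hs : lam n + ρ • ((p + r) (y (n + 1)) - p (y n)) =
        lam (n + 1) + ρ • p (y (n + 1) - y n) := by
      rw [hlam, LinearMap.add_apply, map_sub, add_assoc, ← smul_add]
      congr 2
      abel
    rw [hs, LinearMap.add_apply] at h
    simp only [map_add B, map_smul B, map_add (B _), LinearMap.add_apply, LinearMap.smul_apply,
      smul_eq_mul, hlamp, horth'] at h
    linarith
  -- Indices are shifted by one: only `y 1, y 2, …` are known to be minimizers.
  set a : ℕ → ℝ := fun n => B (r (y (n + 1))) (r (y (n + 1))) with ha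
  set b : ℕ → ℝ := fun n => B (p (y (n + 1) - y n)) (p (y (n + 1) - y n)) with hb
  set φ : ℕ → ℝ := fun n => F (y (n + 1)) + B (lam (n + 1)) (r (y (n + 1))) with hφ
  have hsq : ∀ u w : E, 2 * B u w ≤ B u u + B w w := fun u w => by
    have h := hpos (u - w)
    simp only [map_sub, LinearMap.sub_apply] at h
    linarith [hsymm u w]
  have hincr : ∀ n, φ n + ρ * a (n + 1) - ρ / 2 * (b n + b (n + 1)) ≤ φ (n + 1) := by
    intro n
    have h := hgrow n _ (hmem (n + 1 + 1))
    have hb' := hsq (p (y (n + 1) - y n)) (p (y (n + 1 + 1) - y (n + 1)))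
    have hlam' : B (lam (n + 1 + 1)) (r (y (n + 1 + 1))) =
        B (lam (n + 1)) (r (y (n + 1 + 1))) + ρ * a (n + 1) := by
      rw [hlam (n + 1)]; simp [ha]
    have hr : B (lam (n + 1)) (r (y (n + 1 + 1) - y (n + 1))) =
        B (lam (n + 1)) (r (y (n + 1 + 1))) - B (lam (n + 1)) (r (y (n + 1))) := by simp
    have := mul_le_mul_of_nonneg_left hb' hρ.le
    simp only [hφ]
    rw [hlam']
    simp only [hb]
    linarith [hF₀ (y (n + 1 + 1) - y (n + 1))]
  -- Two consecutive growth inequalities, each tested with the other's minimizer, are added: the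
  -- costs cancel, and of the multipliers only their difference `ρ • r₂` remains. One of the two
  -- quadratic remainders is discarded; the other one and `B (r Δ) (r Δ)` feed the coercivity bound.
  have hdiss : ∀ n, a (n + 1) + b (n + 1) + min 1 (2 / ρ) / c * b (n + 1) ≤ a n + b n := by
    intro n
    have h₁ := hgrow n _ (hmem (n + 1 + 1))
    have h₂ := hgrow (n + 1) _ (hmem (n + 1))
    have hneg : y (n + 1) - y (n + 1 + 1) = -(y (n + 1 + 1) - y (n + 1)) := by abel
    have hF' := hF₀ (y (n + 1) - y (n + 1 + 1))
    rw [hneg] at h₂ hF'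
    set Δ := y (n + 1 + 1) - y (n + 1) with hΔ
    set Δ' := y (n + 1) - y n
    set r₁ := r (y (n + 1))
    set r₂ := r (y (n + 1 + 1)) with hr₂
    have hrΔ : r Δ = r₂ - r₁ := by rw [hΔ, map_sub]
    rw [hlam (n + 1), ← hr₂] at h₂
    simp only [map_neg, map_add B, map_smul B, LinearMap.add_apply, LinearMap.smul_apply,
      smul_eq_mul] at h₂
    have hkey : F Δ + ρ * B r₂ (r Δ) + ρ * B (p Δ) (p Δ) - ρ * B (p Δ') (p Δ) ≤ 0 := by
      linarith
    have hc' := hcoer Δ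
    have hsqp := hsq (p Δ') (p Δ)
    have hpol : 2 * B r₂ (r Δ) = B r₂ r₂ - B r₁ r₁ + B (r Δ) (r Δ) := by
      rw [hrΔ]
      simp only [map_sub, LinearMap.sub_apply]
      linarith [hsymm r₁ r₂]
    have hmain : a (n + 1) + b (n + 1) + (B (r Δ) (r Δ) + 2 / ρ * F Δ) ≤ a n + b n := by
      change B r₂ r₂ + B (p Δ) (p Δ) + _ ≤ B r₁ r₁ + B (p Δ') (p Δ')
      have hdiv : 2 / ρ * (F Δ + ρ * B r₂ (r Δ) + ρ * B (p Δ) (p Δ) - ρ * B (p Δ') (p Δ)) ≤ 0 :=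
        mul_nonpos_of_nonneg_of_nonpos (div_pos two_pos hρ).le hkey
      have hexp : 2 / ρ * (F Δ + ρ * B r₂ (r Δ) + ρ * B (p Δ) (p Δ) - ρ * B (p Δ') (p Δ)) =
          2 / ρ * F Δ + 2 * B r₂ (r Δ) + 2 * B (p Δ) (p Δ) - 2 * B (p Δ') (p Δ) := by
        field_simp
      linarith
    have hγ : min 1 (2 / ρ) / c * b (n + 1) ≤ B (r Δ) (r Δ) + 2 / ρ * F Δ := by
      have hγ₀ : 0 < min 1 (2 / ρ) := lt_min one_pos (div_pos two_pos hρ)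
      have h₁ : min 1 (2 / ρ) / c * b (n + 1) ≤ min 1 (2 / ρ) * (F Δ + B (r Δ) (r Δ)) := by
        rw [div_mul_eq_mul_div, div_le_iff₀ hc, mul_assoc, mul_comm _ c]
        exact mul_le_mul_of_nonneg_left hc' hγ₀.le
      have h₂ := mul_le_mul_of_nonneg_right (min_le_left 1 (2 / ρ)) (hpos (r Δ))
      have h₃ := mul_le_mul_of_nonneg_right (min_le_right 1 (2 / ρ)) (hF₀ Δ)
      linarith
    linarith
  -- Test with the feasible point: as `r y' = 0`, the multiplier term becomes the one in `φ`,
  -- whatever the size of `lam`.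
  have hupper : ∀ n, φ n ≤ F y' - F (y' - y (n + 1)) / 2
      + (ρ ^ 2 * c / 2 + 1 / 2) * (a n + b n) := by
    intro n
    have h := hgrow n _ hy'
    set d := y' - y (n + 1) with hd
    set Δ := y (n + 1) - y n
    have hrd : r d = -r (y (n + 1)) := by rw [hd, map_sub, hr', zero_sub]
    have hcd := hcoer d
    -- Young's inequality with weight `ρ * c`, chosen so that coercivity absorbs the cross term into
    -- only half of `F d`.
    have hs := hsq ((ρ * c) • p Δ) (p d)
    rw [hrd, map_neg] at h
    rw [hrd] at hcd
    simp only [map_neg, LinearMap.neg_apply, neg_neg] at hcd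
    simp only [map_smul, LinearMap.smul_apply, smul_eq_mul] at hs
    have hs' : ρ * B (p Δ) (p d) ≤ ρ ^ 2 * c / 2 * b n + (F d + a n) / 2 := by
      refine le_of_mul_le_mul_left ?_ hc
      change _ ≤ c * (ρ ^ 2 * c / 2 * B (p Δ) (p Δ) + (F d + B (r (y (n + 1))) (r (y (n + 1)))) / 2)
      nlinarith
    have ha₀ : 0 ≤ ρ ^ 2 * c / 2 * a n := mul_nonneg (by positivity) (hpos _)
    have hb₀ : 0 ≤ b n := hpos _
    simp only [hφ]
    linarith
  obtain ⟨⟨K, hK⟩, hlim⟩ := bounded_and_tendsto_zero_of_dissipation (a := a) (b := b) (φ := φ)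
    (e := fun n => F (y' - y (n + 1))) (fun n => hpos _) (fun n => hpos _) (fun n => hF₀ _)
    (div_pos (lt_min one_pos (div_pos two_pos hρ)) hc) hρ (by positivity) hdiss hincr hupper
  refine ⟨⟨max K (F (y' - y 0)), fun n => ?_⟩, (tendsto_add_atTop_iff_nat 1).1 hlim⟩
  cases n with
  | zero => exact le_max_right _ _
  | succ n => exact (hK n).trans (le_max_left _ _)

end ConsensusADMM

/-! ### Coercivity of homogeneous quadratic functions. -/

/-- A continuous positive definite function that is homogeneous of degree two on a finite-dimensional
space dominates a multiple of the squared norm. -/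
theorem exists_norm_sq_le_mul_of_homogeneous {V : Type*} [NormedAddCommGroup V] [NormedSpace ℝ V]
    [FiniteDimensional ℝ V] {G : V → ℝ} (hG : Continuous G)
    (hhom : ∀ (t : ℝ) y, G (t • y) = t ^ 2 * G y) (hpos : ∀ y, y ≠ 0 → 0 < G y) :
    ∃ c, 0 < c ∧ ∀ y, ‖y‖ ^ 2 ≤ c * G y := by
  have : ProperSpace V := FiniteDimensional.proper_real V
  have h0 : G 0 = 0 := by simpa using hhom 0 0
  -- The sphere is empty exactly when `V` is trivial; otherwise the minimum of `G` on it gives the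
  -- constant.
  rcases (Metric.sphere (0 : V) 1).eq_empty_or_nonempty with hempty | hne
  · refine ⟨1, one_pos, fun y => ?_⟩
    have hy : y = 0 := by
      by_contra hy
      have : ‖y‖⁻¹ • y ∈ Metric.sphere (0 : V) 1 := by
        simp [norm_smul, norm_ne_zero_iff.2 hy]
      rw [hempty] at this
      exact this
    simp [hy, h0]
  · obtain ⟨y₀, hy₀, hmin⟩ := (isCompact_sphere (0 : V) 1).exists_isMinOn hne hG.continuousOn
    have hy₀' : y₀ ≠ 0 := by
      rintro rfl
      simp at hy₀
    have hG₀ := hpos _ hy₀'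
    refine ⟨(G y₀)⁻¹, inv_pos.2 hG₀, fun y => ?_⟩
    by_cases hy : y = 0
    · simp [hy, h0]
    have hny : 0 < ‖y‖ := norm_pos_iff.2 hy
    have h : G y₀ ≤ G (‖y‖⁻¹ • y) := hmin (by simp [norm_smul, hny.ne'])
    rw [hhom, inv_pow, inv_mul_eq_div, le_div_iff₀ (by positivity)] at h
    rw [inv_mul_eq_div, le_div_iff₀ hG₀]
    linarith

theorem real_dotProduct_self_nonneg {ι : Type*} [Fintype ι] (v : ι → ℝ) : 0 ≤ v ⬝ᵥ v :=
  Finset.sum_nonneg fun _ _ => mul_self_nonneg _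

namespace PWANetwork

variable (S : PWANetwork)

/-! ### The consensus structure of the network -/

/-- The Euclidean inner product of families of augmented trajectories, as a bilinear form. -/
def augForm : LinearMap.BilinForm ℝ (∀ i, S.AugTraj i) :=
  LinearMap.mk₂ ℝ (fun v w => ∑ i, S.augInner (v i) (w i))
    (fun v v' w => by
      simp only [augInner, Pi.add_apply, Prod.fst_add, Prod.snd_add, add_dotProduct,
        Finset.sum_add_distrib]
      ring)
    (fun t v w => by
      simp only [augInner, Pi.smul_apply, Prod.smul_fst, Prod.smul_snd, smul_dotProduct,
        ← Finset.smul_sum, ← smul_add])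
    (fun v w w' => by
      simp only [augInner, Pi.add_apply, Prod.fst_add, Prod.snd_add, dotProduct_add,
        Finset.sum_add_distrib]
      ring)
    (fun t v w => by
      simp only [augInner, Pi.smul_apply, Prod.smul_fst, Prod.smul_snd, dotProduct_smul,
        ← Finset.smul_sum, ← smul_add])

theorem augForm_apply (v w : ∀ i, S.AugTraj i) :
    S.augForm v w = ∑ i, S.augInner (v i) (w i) := rfl

theorem augForm_symm (v w : ∀ i, S.AugTraj i) : S.augForm v w = S.augForm w v := by
  simp only [augForm_apply, augInner, dotProduct_comm]

theorem augInner_self_nonneg {i : Fin S.M} (v : S.AugTraj i) : 0 ≤ S.augInner v v :=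
  add_nonneg (Finset.sum_nonneg fun _ _ => real_dotProduct_self_nonneg _)
    (Finset.sum_nonneg fun _ _ => Finset.sum_nonneg fun _ _ => real_dotProduct_self_nonneg _)

theorem augInner_self_eq_zero {i : Fin S.M} {v : S.AugTraj i} :
    S.augInner v v = 0 ↔ v = 0 := by
  refine ⟨fun h => ?_, fun h => by simp [h, augInner]⟩
  have h₁ : 0 ≤ ∑ k, v.1 k ⬝ᵥ v.1 k := Finset.sum_nonneg fun _ _ => real_dotProduct_self_nonneg _
  have h₂ : ∀ j, 0 ≤ ∑ k, v.2 j k ⬝ᵥ v.2 j k :=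
    fun j => Finset.sum_nonneg fun _ _ => real_dotProduct_self_nonneg _
  rw [augInner, add_eq_zero_iff_of_nonneg h₁ (Finset.sum_nonneg fun j _ => h₂ j),
    Finset.sum_eq_zero_iff_of_nonneg fun _ _ => real_dotProduct_self_nonneg _,
    Finset.sum_eq_zero_iff_of_nonneg fun j _ => h₂ j] at h
  ext1
  · funext k
    exact dotProduct_self_eq_zero.1 (h.1 k (Finset.mem_univ _))
  · funext j k
    have := (Finset.sum_eq_zero_iff_of_nonneg fun _ _ => real_dotProduct_self_nonneg _).1
      (h.2 j (Finset.mem_univ _)) k (Finset.mem_univ _)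
    exact dotProduct_self_eq_zero.1 this

theorem augForm_self_nonneg (v : ∀ i, S.AugTraj i) : 0 ≤ S.augForm v v := by
  rw [augForm_apply]
  exact Finset.sum_nonneg fun _ _ => S.augInner_self_nonneg _

theorem continuous_augForm_self (f : S.Var →ₗ[ℝ] ∀ i, S.AugTraj i) :
    Continuous fun y => S.augForm (f y) (f y) := by
  have hf : Continuous f := f.continuous_of_finiteDimensional
  simp only [augForm_apply, augInner]
  fun_prop

theorem augForm_self_eq_zero {v : ∀ i, S.AugTraj i} : S.augForm v v = 0 ↔ v = 0 := by
  rw [augForm_apply, Finset.sum_eq_zero_iff_of_nonneg fun _ _ => S.augInner_self_nonneg _]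
  simp only [Finset.mem_univ, true_implies, augInner_self_eq_zero, funext_iff, Pi.zero_apply]

/-- The consensus part of a global variable: all trajectories and copies replaced by the
averages. -/
noncomputable def consensusPart : S.Var →ₗ[ℝ] ∀ i, S.AugTraj i where
  toFun y := S.augOf (S.average y)
  map_add' y w := by
    have h : S.average (y + w) = S.average y + S.average w := by
      funext i
      simp only [average, copy, own, Pi.add_apply, Prod.fst_add, Prod.snd_add,
        Finset.sum_add_distrib, ← smul_add]
      congr 1
      abel
    rw [h]
    rfl
  map_smul' t y := by
    have h : S.average (t • y) = t • S.average y := by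
      funext i
      simp only [average, copy, own, Pi.smul_apply, Prod.smul_fst, Prod.smul_snd,
        ← Finset.smul_sum, ← smul_add]
      rw [smul_comm]
    rw [h]
    rfl

/-- The consensus residual of a global variable. -/
noncomputable def residual : S.Var →ₗ[ℝ] ∀ i, S.AugTraj i :=
  LinearMap.pi (fun i => LinearMap.fst ℝ _ _ ∘ₗ LinearMap.proj i) - S.consensusPart

theorem consensusPart_apply (y : S.Var) (i : Fin S.M) :
    S.consensusPart y i = S.augOf (S.average y) i := rfl

theorem residual_apply (y : S.Var) (i : Fin S.M) :
    S.residual y i = (y i).1 - S.augOf (S.average y) i := rfl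

theorem consensusPart_add_residual_apply (y : S.Var) (i : Fin S.M) :
    (S.consensusPart + S.residual) y i = (y i).1 := by
  rw [LinearMap.add_apply, Pi.add_apply, residual_apply, consensusPart_apply, add_sub_cancel]

/-- Sums over the pairs of a subsystem and one of its neighbors can be taken in either order. -/
theorem sum_neighbors_comm (f : ∀ i j : Fin S.M, j ∈ S.nbr i → ℝ) :
    ∑ i, ∑ j : S.Nb i, f i j j.2 = ∑ j, ∑ i : {i : Fin S.M // j ∈ S.nbr i}, f i j i.2 := by
  rw [Finset.sum_sigma', Finset.sum_sigma']
  exact Finset.sum_bij' (fun a _ => ⟨a.2.1, a.1, a.2.2⟩) (fun a _ => ⟨a.2.1, a.1, a.2.2⟩)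
    (fun _ _ => Finset.mem_univ _) (fun _ _ => Finset.mem_univ _)
    (fun _ _ => rfl) (fun _ _ => rfl) (fun _ _ => rfl)

theorem card_smul_average (y : S.Var) (i : Fin S.M) :
    ((Fintype.card {j : Fin S.M // i ∈ S.nbr j} : ℝ) + 1) • S.average y i =
      own (y i) + ∑ j : {j : Fin S.M // i ∈ S.nbr j}, copy (y j) ⟨i, j.2⟩ := by
  rw [average, smul_inv_smul₀ (by positivity)]

/-- The deviations of a trajectory and of all its copies from their average sum to zero. Reordering
the neighbor sum by the owner of the copied trajectory pairs them all with the same `z i`. -/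
theorem augForm_residual_augOf (y : S.Var) (z : ∀ i, S.Traj i) :
    S.augForm (S.residual y) (S.augOf z) = 0 := by
  simp only [augForm_apply, augInner, Finset.sum_add_distrib]
  rw [S.sum_neighbors_comm fun i j hj =>
    ∑ k, (S.residual y i).2 ⟨j, hj⟩ k ⬝ᵥ (S.augOf z i).2 ⟨j, hj⟩ k, ← Finset.sum_add_distrib]
  refine Finset.sum_eq_zero fun i _ => ?_
  rw [Finset.sum_comm, ← Finset.sum_add_distrib]
  refine Finset.sum_eq_zero fun k _ => ?_
  set c : {j : Fin S.M // i ∈ S.nbr j} → S.Traj i := fun j => copy (y j) ⟨i, j.2⟩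
  have h : _ = own (y i) k + ∑ j, c j k :=
    (congrFun (S.card_smul_average y i) k).trans
      (congrArg (own (y i) k + ·) (Finset.sum_apply k Finset.univ c))
  simp only [residual_apply, augOf, Prod.fst_sub, Prod.snd_sub, Pi.sub_apply]
  refine (congrArg (((y i).1.1 k - S.average y i k) ⬝ᵥ z i k + ·) (sum_dotProduct Finset.univ
    (fun j => c j k - S.average y i k)
    (z i k)).symm).trans ?_
  rw [← add_dotProduct, Finset.sum_sub_distrib]
  simp only [Pi.smul_apply, own, add_smul, one_smul] at h
  have h0 : (y i).1.1 k - S.average y i k + (∑ j, c j k -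
      ∑ _j : {j : Fin S.M // i ∈ S.nbr j}, S.average y i k) = 0 := by
    rw [Finset.sum_const, Finset.card_univ, ← Nat.cast_smul_eq_nsmul ℝ, sub_add_sub_comm, ← h]
    abel
  rw [h0, zero_dotProduct]

theorem consistent_of_residual_eq_zero {y : S.Var} (h : S.residual y = 0) : S.Consistent y := by
  intro i j
  have h₁ := congrArg (fun v : S.AugTraj i => v.2 j) (congrFun h i)
  have h₂ := congrArg (fun v : S.AugTraj j => v.1) (congrFun h j)
  simp only [residual_apply, augOf, Prod.snd_sub, Prod.fst_sub, Pi.sub_apply, Pi.zero_apply,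
    Prod.snd_zero, Prod.fst_zero, sub_eq_zero] at h₁ h₂
  exact h₁.trans h₂.symm

theorem residual_eq_zero_of_consistent {y : S.Var} (h : S.Consistent y) : S.residual y = 0 := by
  have havg : ∀ i, S.average y i = own (y i) := fun i => by
    have hcopy : ∀ j : {j : Fin S.M // i ∈ S.nbr j}, copy (y j) ⟨i, j.2⟩ = own (y i) :=
      fun j => h j ⟨i, j.2⟩
    rw [average, Finset.sum_congr rfl fun j _ => hcopy j, Finset.sum_const, Finset.card_univ,
      ← Nat.cast_smul_eq_nsmul ℝ, inv_smul_eq_iff₀ (by positivity), add_smul, one_smul, add_comm]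
  funext i
  rw [residual_apply]
  ext1
  · simp [augOf, havg]
  · funext j
    have := h i j
    simp only [copy] at this
    simp [augOf, havg, this]

/-! ### The total cost -/

/-- The sum of the local costs. -/
def totalCost (y : S.Var) : ℝ := ∑ i, S.cost i (y i)

theorem dotProduct_mulVec_convexComb {d : ℕ} (M : Matrix (Fin d) (Fin d) ℝ) (a b : Fin d → ℝ)
    (t : ℝ) : (a + t • (b - a)) ⬝ᵥ (M *ᵥ (a + t • (b - a))) =
      (1 - t) * (a ⬝ᵥ (M *ᵥ a)) + t * (b ⬝ᵥ (M *ᵥ b))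
        - t * (1 - t) * ((b - a) ⬝ᵥ (M *ᵥ (b - a))) := by
  simp only [mulVec_add, mulVec_sub, mulVec_smul, add_dotProduct, dotProduct_add, sub_dotProduct,
    dotProduct_sub, smul_dotProduct, dotProduct_smul, smul_eq_mul]
  ring

theorem dotProduct_mulVec_smul {d : ℕ} (M : Matrix (Fin d) (Fin d) ℝ) (a : Fin d → ℝ)
    (t : ℝ) : (t • a) ⬝ᵥ (M *ᵥ (t • a)) = t ^ 2 * (a ⬝ᵥ (M *ᵥ a)) := by
  simp only [mulVec_smul, smul_dotProduct, dotProduct_smul, smul_eq_mul]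
  ring

/-- The cost is a pure quadratic form, so this is an identity. It stands in for both
differentiability and strong convexity in the ADMM estimates. -/
theorem totalCost_convexComb (a b : S.Var) (t : ℝ) :
    S.totalCost (a + t • (b - a)) = (1 - t) * S.totalCost a + t * S.totalCost b
      - t * (1 - t) * S.totalCost (b - a) := by
  simp only [totalCost, cost, stageCost, termCost, own, copy, inp, Finset.mul_sum,
    ← Finset.sum_add_distrib, ← Finset.sum_sub_distrib]
  refine Finset.sum_congr rfl fun i _ => ?_
  simp only [Pi.add_apply, Pi.smul_apply, Pi.sub_apply, Prod.fst_add, Prod.snd_add, Prod.smul_fst,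
    Prod.smul_snd, Prod.fst_sub, Prod.snd_sub, dotProduct_mulVec_convexComb,
    Finset.sum_add_distrib, Finset.sum_sub_distrib, ← Finset.mul_sum]
  ring

theorem totalCost_smul (t : ℝ) (y : S.Var) : S.totalCost (t • y) = t ^ 2 * S.totalCost y := by
  simp only [totalCost, cost, stageCost, termCost, own, copy, inp, Pi.smul_apply, Prod.smul_fst,
    Prod.smul_snd, dotProduct_mulVec_smul, mul_add, Finset.mul_sum]

theorem continuous_totalCost : Continuous S.totalCost := by
  unfold totalCost cost stageCost termCost own copy inp
  fun_prop

variable {S}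

theorem LyapunovAssumption.stageCost_nonneg (h5 : S.LyapunovAssumption) (i : Fin S.M)
    (xi : Fin (S.n i) → ℝ) (ui : Fin (S.m i) → ℝ) (xj : ∀ j : S.Nb i, Fin (S.n j) → ℝ) :
    0 ≤ S.stageCost i xi ui xj :=
  add_nonneg (add_nonneg ((h5.Q_posDef i).posSemidef.dotProduct_mulVec_nonneg xi)
    ((h5.R_posDef i).posSemidef.dotProduct_mulVec_nonneg ui))
    (Finset.sum_nonneg fun j _ => (h5.Qc_posSemidef i j j.2).dotProduct_mulVec_nonneg (xj j))

theorem LyapunovAssumption.termCost_nonneg (h5 : S.LyapunovAssumption) (i : Fin S.M)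
    (xi : Fin (S.n i) → ℝ) : 0 ≤ S.termCost i xi :=
  (h5.Phi_posDef i).posSemidef.dotProduct_mulVec_nonneg xi

theorem LyapunovAssumption.cost_nonneg (h5 : S.LyapunovAssumption) (i : Fin S.M)
    (y : S.LocalVar i) : 0 ≤ S.cost i y :=
  add_nonneg (Finset.sum_nonneg fun _ _ => h5.stageCost_nonneg _ _ _ _) (h5.termCost_nonneg _ _)

theorem LyapunovAssumption.totalCost_nonneg (h5 : S.LyapunovAssumption) (y : S.Var) :
    0 ≤ S.totalCost y := Finset.sum_nonneg fun _ _ => h5.cost_nonneg _ _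

theorem _root_.Matrix.PosDef.eq_zero_of_dotProduct_mulVec_nonpos {d : ℕ}
    {M : Matrix (Fin d) (Fin d) ℝ} (hM : M.PosDef) {x : Fin d → ℝ} (h : x ⬝ᵥ (M *ᵥ x) ≤ 0) :
    x = 0 := by
  by_contra hx
  exact absurd (hM.dotProduct_mulVec_pos hx) (not_lt.2 h)

/-- Positive definite stage weights cover the times before `N`, the terminal weight covers `N`. The
copies escape because `Qc` is only semidefinite; the residual has to control them. -/
theorem LyapunovAssumption.own_inp_eq_zero (h5 : S.LyapunovAssumption) {i : Fin S.M}
    {y : S.LocalVar i} (h : S.cost i y = 0) : own y = 0 ∧ inp y = 0 := by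
  rw [cost, add_eq_zero_iff_of_nonneg (Finset.sum_nonneg fun _ _ => h5.stageCost_nonneg _ _ _ _)
    (h5.termCost_nonneg _ _),
    Finset.sum_eq_zero_iff_of_nonneg fun _ _ => h5.stageCost_nonneg _ _ _ _] at h
  have hk : ∀ k : Fin S.N, own y k.castSucc = 0 ∧ inp y k = 0 := fun k => by
    have hs := h.1 k (Finset.mem_univ _)
    have hQ := (h5.Q_posDef i).posSemidef.dotProduct_mulVec_nonneg (own y k.castSucc)
    have hR := (h5.R_posDef i).posSemidef.dotProduct_mulVec_nonneg (inp y k)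
    have hQc : 0 ≤ ∑ j : S.Nb i, copy y j k.castSucc ⬝ᵥ (S.Qc i j *ᵥ copy y j k.castSucc) :=
      Finset.sum_nonneg fun j _ =>
        (h5.Qc_posSemidef i j j.2).dotProduct_mulVec_nonneg (copy y j k.castSucc)
    simp only [stageCost] at hs
    simp only [star_trivial] at hQ hR
    exact ⟨(h5.Q_posDef i).eq_zero_of_dotProduct_mulVec_nonpos (by linarith),
      (h5.R_posDef i).eq_zero_of_dotProduct_mulVec_nonpos (by linarith)⟩
  refine ⟨funext fun k => ?_, funext fun k => (hk k).2⟩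
  induction k using Fin.lastCases with
  | last => exact (h5.Phi_posDef i).eq_zero_of_dotProduct_mulVec_nonpos h.2.le
  | cast k => exact (hk k).1

/-- The total cost and the squared residual together are coercive. -/
theorem LyapunovAssumption.exists_norm_sq_le (h5 : S.LyapunovAssumption) :
    ∃ c, 0 < c ∧ ∀ y : S.Var,
      ‖y‖ ^ 2 ≤ c * (S.totalCost y + S.augForm (S.residual y) (S.residual y)) := by
  have hcont := S.continuous_augForm_self S.residual
  refine exists_norm_sq_le_mul_of_homogeneous (S.continuous_totalCost.add hcont)
    (fun t y => ?_) fun y hy => ?_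
  · simp only [totalCost_smul, map_smul, LinearMap.smul_apply, smul_eq_mul]
    ring
  · have hF := h5.totalCost_nonneg y
    have hB := S.augForm_self_nonneg (S.residual y)
    refine lt_of_le_of_ne (add_nonneg hF hB) fun h => hy ?_
    obtain ⟨hF₀, hB₀⟩ := (add_eq_zero_iff_of_nonneg hF hB).1 h.symm
    rw [totalCost, Finset.sum_eq_zero_iff_of_nonneg fun _ _ => h5.cost_nonneg _ _] at hF₀
    have hcons := S.consistent_of_residual_eq_zero (S.augForm_self_eq_zero.1 hB₀)
    have h0 := fun i => h5.own_inp_eq_zero (hF₀ i (Finset.mem_univ _))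
    funext i
    refine Prod.ext (Prod.ext (h0 i).1 (funext fun j => ?_)) (h0 i).2
    exact (hcons i j).trans (h0 j).1

/-- The squared consensus part is dominated by the total cost and the squared residual. -/
theorem LyapunovAssumption.exists_consensusPart_le (h5 : S.LyapunovAssumption) :
    ∃ c, 0 < c ∧ ∀ y : S.Var, S.augForm (S.consensusPart y) (S.consensusPart y) ≤
      c * (S.totalCost y + S.augForm (S.residual y) (S.residual y)) := by
  obtain ⟨c, hc, h⟩ := h5.exists_norm_sq_le
  have hcont := S.continuous_augForm_self S.consensusPart
  have hG₀ : ∀ y : S.Var, 0 ≤ S.totalCost y + S.augForm (S.residual y) (S.residual y) :=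
    fun y => add_nonneg (h5.totalCost_nonneg y) (S.augForm_self_nonneg _)
  -- A bound on the unit ball extends to all of the space by homogeneity; `max C 1` below only
  -- serves to have a positive constant.
  obtain ⟨C, hC⟩ := (isCompact_closedBall (0 : S.Var) 1).bddAbove_image hcont.continuousOn
  have hC' : ∀ y : S.Var, S.augForm (S.consensusPart y) (S.consensusPart y) ≤ max C 1 * ‖y‖ ^ 2 := by
    intro y
    by_cases hy : y = 0
    · simp [hy]
    have hny : 0 < ‖y‖ := norm_pos_iff.2 hy
    have h' := hC (Set.mem_image_of_mem _ (show ‖y‖⁻¹ • y ∈ Metric.closedBall (0 : S.Var) 1 by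
      simp [norm_smul, hny.ne']))
    simp only [map_smul, LinearMap.smul_apply, smul_eq_mul] at h'
    rw [← mul_assoc, ← mul_inv, inv_mul_eq_div, div_le_iff₀ (by positivity)] at h'
    refine h'.trans ?_
    rw [sq]
    exact mul_le_mul_of_nonneg_right (le_max_left _ _) (by positivity)
  refine ⟨max C 1 * c, by positivity, fun y => (hC' y).trans ?_⟩
  rw [mul_assoc]
  exact mul_le_mul_of_nonneg_left (h y) (by positivity)

/-! ### Convexity and closedness of the constraint sets -/

theorem _root_.IsPolyhedron.isClosed {d : ℕ} {P : Set (Fin d → ℝ)} (h : IsPolyhedron P) :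
    IsClosed P := by
  obtain ⟨r, a, b, rfl⟩ := h
  simp only [Set.ofPred_forall]
  exact isClosed_iInter fun e => isClosed_le (by fun_prop) continuous_const

theorem _root_.IsPolyhedron.convex {d : ℕ} {P : Set (Fin d → ℝ)} (h : IsPolyhedron P) :
    Convex ℝ P := by
  obtain ⟨r, a, b, rfl⟩ := h
  intro x hx y hy s t hs ht hst e
  simp only [dotProduct_add, dotProduct_smul, smul_eq_mul]
  calc s * (a e ⬝ᵥ x) + t * (a e ⬝ᵥ y) ≤ s * b e + t * b e :=
        add_le_add (mul_le_mul_of_nonneg_left (hx e) hs) (mul_le_mul_of_nonneg_left (hy e) ht)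
    _ = b e := by rw [← add_mul, hst, one_mul]

/-- Closedness comes from the finite cover by closed polyhedra. -/
theorem Standing.isClosed_X (hS : S.Standing) (i : Fin S.M) : IsClosed (S.X i) := by
  rw [← hS.P_cover i]
  exact isClosed_iUnion_of_finite fun l => (hS.P_polyhedron i l).isClosed

theorem isClosed_localSet (hS : S.Standing) (h4 : S.TerminalAssumption) (i : Fin S.M)
    (xi : Fin (S.n i) → ℝ) : IsClosed (S.localSet i xi) := by
  simp only [localSet, Set.ofPred_and, Set.ofPred_forall]
  refine (isClosed_iInter fun k => ?_).inter ((isClosed_iInter fun k => ?_).inter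
    ((isClosed_iInter fun k => ?_).inter (IsClosed.inter ?_ ?_)))
  · exact isClosed_le (by unfold own copy; fun_prop) continuous_const
  · exact (hS.isClosed_X i).preimage (by unfold own; fun_prop)
  · exact (hS.U_closed i).preimage (by unfold inp; fun_prop)
  · exact isClosed_eq (by unfold own; fun_prop) continuous_const
  · exact (h4.closed i).preimage (by unfold own; fun_prop)

theorem isClosed_switchSet (hS : S.Standing) (i : Fin S.M) (s : S.Switching i) :
    IsClosed (S.switchSet i s) := by
  simp only [switchSet, Set.ofPred_and, Set.ofPred_forall]
  refine (isClosed_iInter fun k => ?_).inter (isClosed_iInter fun k => ?_)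
  · exact isClosed_eq (by unfold own; fun_prop) (by unfold piece own inp copy; fun_prop)
  · exact (hS.P_polyhedron i _).isClosed.preimage (by unfold own; fun_prop)

theorem piece_convexComb (i : Fin S.M) (l : Fin (S.L i)) (x x' : Fin (S.n i) → ℝ)
    (u u' : Fin (S.m i) → ℝ) (xj xj' : ∀ j : S.Nb i, Fin (S.n j) → ℝ) {a b : ℝ} (hab : a + b = 1) :
    S.piece i l (a • x + b • x') (a • u + b • u') (fun j => a • xj j + b • xj' j) =
      a • S.piece i l x u xj + b • S.piece i l x' u' xj' := by
  have hc : S.c i l = a • S.c i l + b • S.c i l := by rw [← add_smul, hab, one_smul]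
  simp only [piece, mulVec_add, mulVec_smul, Finset.sum_add_distrib, ← Finset.smul_sum, smul_add]
  nth_rewrite 1 [hc]
  abel

theorem convex_localSet (hS : S.Standing) (h4 : S.TerminalAssumption) (i : Fin S.M)
    (xi : Fin (S.n i) → ℝ) : Convex ℝ (S.localSet i xi) := by
  intro y hy w hw a b ha hb hab
  obtain ⟨hy₁, hy₂, hy₃, hy₄, hy₅⟩ := hy
  obtain ⟨hw₁, hw₂, hw₃, hw₄, hw₅⟩ := hw
  refine ⟨fun k => ?_, fun k => hS.X_convex i (hy₂ k) (hw₂ k) ha hb hab,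
    fun k => hS.U_convex i (hy₃ k) (hw₃ k) ha hb hab, ?_, h4.convex i hy₅ hw₅ ha hb hab⟩
  · have h := add_le_add (smul_le_smul_of_nonneg_left (hy₁ k) ha)
      (smul_le_smul_of_nonneg_left (hw₁ k) hb)
    rw [← add_smul, hab, one_smul] at h
    refine le_trans (le_of_eq ?_) h
    simp only [own, copy, Prod.fst_add, Prod.snd_add, Prod.smul_fst, Prod.smul_snd, Pi.add_apply,
      Pi.smul_apply, mulVec_add, mulVec_smul, Finset.sum_add_distrib, ← Finset.smul_sum, smul_add]
    abel
  · change a • own y 0 + b • own w 0 = xi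
    rw [hy₄, hw₄, ← add_smul, hab, one_smul]

theorem convex_switchSet (hS : S.Standing) (i : Fin S.M) (s : S.Switching i) :
    Convex ℝ (S.switchSet i s) := by
  intro y hy w hw a b ha hb hab
  refine ⟨fun k => ?_, fun k => (hS.P_polyhedron i _).convex (hy.2 k) (hw.2 k) ha hb hab⟩
  change a • own y k.succ + b • own w k.succ = _
  rw [hy.1 k, hw.1 k, ← piece_convexComb i _ _ _ _ _ _ _ hab]
  rfl

/-! ### Convergence of the switching ADMM procedure -/

namespace IsSwADMM

variable {x : S.State} {w : ∀ i, S.InputSeq i} {ydr : S.Var} {s : ℕ → ∀ i, S.Switching i}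
  {y : ℕ → S.Var} {z : ℕ → ∀ i, S.Traj i} {lam : ℕ → ∀ i, S.AugTraj i}

theorem switching_eq (h : S.IsSwADMM x w ydr s y z lam) (n : ℕ) :
    s (n + S.Tcut) = s S.Tcut := by
  induction n with
  | zero => rw [zero_add]
  | succ n ih => rw [add_right_comm, h.s_frozen _ (Nat.le_add_left _ _), ih]

theorem augOf_z_succ (h : S.IsSwADMM x w ydr s y z lam) (τ : ℕ) :
    S.augOf (z (τ + 1)) = S.consensusPart (y (τ + 1)) := by
  rw [show z (τ + 1) = S.average (y (τ + 1)) from funext (h.z_succ τ)]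
  rfl

theorem lam_succ_eq (h : S.IsSwADMM x w ydr s y z lam) (τ : ℕ) :
    lam (τ + 1) = lam τ + S.rho • S.residual (y (τ + 1)) := by
  funext i
  rw [h.lam_succ τ i, h.augOf_z_succ]
  rfl

/-- This lets the abstract ADMM theorem start at a late iteration, where the multiplier need no
longer be zero. -/
theorem augForm_lam_consensusPart (h : S.IsSwADMM x w ydr s y z lam) (τ : ℕ) (d : S.Var) :
    S.augForm (lam τ) (S.consensusPart d) = 0 := by
  induction τ with
  | zero => simp [h.lam_zero]
  | succ τ ih =>
    rw [h.lam_succ_eq, map_add, map_smul, LinearMap.add_apply, LinearMap.smul_apply, ih,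
      show S.augForm (S.residual (y (τ + 1))) (S.consensusPart d) = 0 from
        S.augForm_residual_augOf _ _, smul_zero, add_zero]

/-- The frozen problem of the switching ADMM procedure is feasible. -/
theorem feasibleSetOf_nonempty (h : S.IsSwADMM x w ydr s y z lam) (h1 : S.SwitchingAssumption)
    (hx : x ∈ S.feasibleStates) : (S.feasibleSetOf (s S.Tcut) x).Nonempty := by
  by_contra hempty
  exact h1 x hx ⟨s S.Tcut, Set.not_nonempty_iff_eq_empty.1 hempty,
    fun i => ⟨_, h.y_mem S.Tcut i⟩⟩

/-- The iterates stay bounded and their residuals vanish. -/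
theorem bounded_and_residual_tendsto (h : S.IsSwADMM x w ydr s y z lam) (hS : S.Standing)
    (h4 : S.TerminalAssumption) (h5 : S.LyapunovAssumption)
    (hne : (S.feasibleSetOf (s S.Tcut) x).Nonempty) :
    (∃ K, ∀ n, ‖y (n + (S.Tcut + 1))‖ ≤ K) ∧
      Tendsto (fun n => S.augForm (S.residual (y n)) (S.residual (y n))) atTop (𝓝 0) := by
  obtain ⟨y', hy', hcons⟩ := hne
  have hr' := S.residual_eq_zero_of_consistent hcons
  obtain ⟨c, hc, hcoer⟩ := h5.exists_consensusPart_le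
  set C : Set S.Var :=
    Set.univ.pi fun i => S.localSet i (x i) ∩ S.switchSet i (s S.Tcut i)
  have hC : Convex ℝ C := convex_pi fun i _ =>
    (convex_localSet hS h4 i _).inter (convex_switchSet hS i _)
  -- The iteration is restarted at `Tcut + 1`: this is the first iterate computed with the frozen
  -- sequence, and from index one on `z` is the consensus part of `y`.
  have hmem : ∀ n, y (n + (S.Tcut + 1)) ∈ C := fun n i _ => by
    rw [← h.switching_eq n]
    exact h.y_mem (n + S.Tcut) i
  -- The objective separates over subsystems, so the local minimizations amount to one minimization
  -- over the product set `C`.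
  have hobj : ∀ (lm ζ : ∀ i, S.AugTraj i) (v : S.Var), S.totalCost v +
      S.augForm lm ((S.consensusPart + S.residual) v) + S.rho / 2 *
        S.augForm ((S.consensusPart + S.residual) v - ζ) ((S.consensusPart + S.residual) v - ζ) =
      ∑ i, S.augLagrangian i (lm i) (ζ i) (v i) := fun lm ζ v => by
    simp only [augLagrangian, totalCost, augForm_apply, Pi.sub_apply,
      consensusPart_add_residual_apply, Finset.sum_add_distrib, Finset.mul_sum]
  obtain ⟨⟨K, hK⟩, hlim⟩ := consensusADMM_bounded_and_residual_tendsto S.augForm_symm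
    S.augForm_self_nonneg (p := S.consensusPart) (r := S.residual)
    (fun v v' => S.augForm_residual_augOf v _) h5.totalCost_nonneg S.totalCost_convexComb hc hcoer
    hC hS.rho_pos (y := fun n => y (n + (S.Tcut + 1))) (lam := fun n => lam (n + (S.Tcut + 1)))
    (fun d => h.augForm_lam_consensusPart _ d)
    (fun n => by
      simp only [add_right_comm n 1]
      exact h.lam_succ_eq _)
    hmem
    (fun n v hv => by
      simp only [add_right_comm n 1]
      rw [hobj, hobj]
      refine Finset.sum_le_sum fun i _ => ?_
      have hmin := h.y_min (n + (S.Tcut + 1)) i (v i)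
      rw [show n + (S.Tcut + 1) = n + 1 + S.Tcut by ring, h.switching_eq (n + 1),
        show n + 1 + S.Tcut = n + (S.Tcut + 1) by ring, ← add_assoc n S.Tcut 1,
        h.augOf_z_succ] at hmin
      exact hmin (hv i (Set.mem_univ i)))
    (fun i _ => hy' i) hr'
  obtain ⟨K', hK'⟩ := hlim.bddAbove_range
  refine ⟨?_, (tendsto_add_atTop_iff_nat (S.Tcut + 1)).1 hlim⟩
  obtain ⟨c', hc', hnorm⟩ := h5.exists_norm_sq_le
  refine ⟨‖y'‖ + √(c' * (K + K')), fun n => ?_⟩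
  have hn := hnorm (y' - y (n + (S.Tcut + 1)))
  have hres : S.augForm (S.residual (y' - y (n + (S.Tcut + 1))))
      (S.residual (y' - y (n + (S.Tcut + 1)))) ≤ K' := by
    rw [map_sub, hr', zero_sub, map_neg, map_neg, LinearMap.neg_apply, neg_neg]
    exact hK' (Set.mem_range_self n)
  have hle := Real.le_sqrt_of_sq_le
    (hn.trans (mul_le_mul_of_nonneg_left (add_le_add (hK n) hres) hc'.le))
  linarith [norm_le_norm_add_norm_sub' (y (n + (S.Tcut + 1))) y',
    norm_sub_rev (y (n + (S.Tcut + 1))) y']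

/-- The tail of the iterates stays in a closed ball of a finite-dimensional space, which is compact.
-/
theorem exists_mapClusterPt (h : S.IsSwADMM x w ydr s y z lam) (hS : S.Standing)
    (h4 : S.TerminalAssumption) (h5 : S.LyapunovAssumption)
    (hne : (S.feasibleSetOf (s S.Tcut) x).Nonempty) : ∃ yout, MapClusterPt yout atTop y := by
  obtain ⟨⟨K, hK⟩, -⟩ := h.bounded_and_residual_tendsto hS h4 h5 hne
  have hev : ∀ᶠ n in atTop, y n ∈ Metric.closedBall (0 : S.Var) K := by
    filter_upwards [eventually_ge_atTop (S.Tcut + 1)] with n hn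
    obtain ⟨m, rfl⟩ := Nat.exists_eq_add_of_le' hn
    simpa using hK m
  obtain ⟨yout, -, hy⟩ := (isCompact_closedBall (0 : S.Var) K).exists_mapClusterPt_of_frequently
    hev.frequently
  exact ⟨yout, hy⟩

/-- Every accumulation point of the iterates is feasible for the frozen switching sequence. -/
theorem mem_feasibleSetOf (h : S.IsSwADMM x w ydr s y z lam) (hS : S.Standing)
    (h4 : S.TerminalAssumption) (h5 : S.LyapunovAssumption)
    (hne : (S.feasibleSetOf (s S.Tcut) x).Nonempty) {yout : S.Var}
    (hy : MapClusterPt yout atTop y) : yout ∈ S.feasibleSetOf (s S.Tcut) x := by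
  obtain ⟨-, hlim⟩ := h.bounded_and_residual_tendsto hS h4 h5 hne
  have hclosed : ∀ {D : Set S.Var}, IsClosed D → (∀ n, y (n + (S.Tcut + 1)) ∈ D) → yout ∈ D := by
    intro D hD hmem
    refine hD.mem_of_mapClusterPt hy ?_
    filter_upwards [eventually_ge_atTop (S.Tcut + 1)] with n hn
    obtain ⟨m, rfl⟩ := Nat.exists_eq_add_of_le' hn
    exact hmem m
  refine ⟨fun i => ?_, S.consistent_of_residual_eq_zero (S.augForm_self_eq_zero.1 ?_)⟩
  · refine hclosed (D := {v | v i ∈ S.localSet i (x i) ∩ S.switchSet i (s S.Tcut i)})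
      (((isClosed_localSet hS h4 i _).inter (isClosed_switchSet hS i _)).preimage
        (continuous_apply i)) fun n => ?_
    rw [← h.switching_eq n]
    exact h.y_mem (n + S.Tcut) i
  -- The residual vanishes along the whole sequence, in particular along a subsequence converging to
  -- `yout`, where continuity identifies the limit.
  · obtain ⟨ψ, hψ, hsub⟩ := hy.tendsto_subseq
    exact tendsto_nhds_unique
      (((S.continuous_augForm_self S.residual).tendsto yout).comp hsub) (hlim.comp hψ.tendsto_atTop)

end IsSwADMM

end PWANetwork

namespace PWANetwork

variable {S : PWANetwork}

/-! ### Recursive feasibility -/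

theorem feasibleSetOf_subset_feasibleSet (s : ∀ i, S.Switching i) (x : S.State) :
    S.feasibleSetOf s x ⊆ S.feasibleSet x := fun _ hy =>
  ⟨fun i => (hy.1 i).1, fun i k => ⟨s i k.castSucc, (hy.1 i).2.2 _, (hy.1 i).2.1 k⟩, hy.2⟩

/-- An infeasible rollout has cost `⊤`, which every ADMM output beats. Thus the fallback can only
select a feasible rollout. -/
theorem OptStep.mem_feasibleSet (hS : S.Standing) (h1 : S.SwitchingAssumption)
    (h4 : S.TerminalAssumption) (h5 : S.LyapunovAssumption) {x : S.State}
    (hx : x ∈ S.feasibleStates) {v : ∀ i, S.InputSeq i} {y : S.Var} (h : S.OptStep x v y) :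
    y ∈ S.feasibleSet x := by
  obtain ⟨ydr, yout, -, ⟨s, yit, z, lam, hadmm, hcl⟩, hyes, hno⟩ := h
  by_cases hcost : ∀ i, ((S.cost i (yout i) : ℝ) : EReal) ≤ S.rolloutCost x ydr i
  · rw [hyes hcost]
    exact feasibleSetOf_subset_feasibleSet _ _
      (hadmm.mem_feasibleSetOf hS h4 h5 (hadmm.feasibleSetOf_nonempty h1 hx) hcl)
  · rw [hno hcost]
    by_contra hydr
    exact hcost fun i => by simp [rolloutCost, hydr]

theorem exists_mem_region (h4 : S.TerminalAssumption) {i : Fin S.M} {xi : Fin (S.n i) → ℝ}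
    (hxi : xi ∈ S.XT i) : ∃ l, xi ∈ S.P i l := by
  obtain ⟨l, -, hl⟩ := Set.mem_iUnion₂.1 (h4.subset i hxi)
  exact ⟨l, hl⟩

theorem terminal_subset (hS : S.Standing) (h4 : S.TerminalAssumption) (i : Fin S.M) :
    S.XT i ⊆ S.X i := fun _ hxi => by
  rw [← hS.P_cover i]
  exact Set.mem_iUnion.2 (exists_mem_region h4 hxi)

/-- A feasible solution yields a feasible solution from its second state: shift it by one time step
and append a step of the terminal controller. -/
theorem mem_feasibleStates_of_shift (hS : S.Standing) (h4 : S.TerminalAssumption) {x x' : S.State}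
    {y : S.Var} (hy : y ∈ S.feasibleSet x)
    (hx' : ∀ i, x' i = own (y i) (Fin.succ ⟨0, hS.N_pos⟩)) : x' ∈ S.feasibleStates := by
  obtain ⟨hloc, hdyn, hcons⟩ := hy
  have hT : ∀ i, own (y i) (Fin.last S.N) ∈ S.XT i := fun i => (hloc i).2.2.2.2
  choose l hl using fun i => exists_mem_region h4 (hT i)
  -- Any region containing the terminal state may be used, since invariance and input admissibility
  -- hold for all of them. The neighbors enter with their true terminal states, so the new copies
  -- are consistent by definition.
  set xN : S.State := fun i => S.piece i (l i) (own (y i) (Fin.last S.N))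
    (S.K i (l i) *ᵥ own (y i) (Fin.last S.N)) (fun j => own (y j) (Fin.last S.N))
  have hxNT : xN ∈ S.terminalSet := fun i =>
    h4.invariant i _ (hT i) _ (fun j => hT j) (l i) (hl i)
  set X : ∀ i, S.Traj i := fun i => Fin.snoc (α := fun _ => Fin (S.n i) → ℝ)
    (fun k : Fin S.N => own (y i) k.succ) (xN i) with hX
  set U : ∀ i, S.InputSeq i := fun i k => if h : (k : ℕ) + 1 < S.N then inp (y i) ⟨k + 1, h⟩
    else S.K i (l i) *ᵥ own (y i) (Fin.last S.N) with hU
  have hXc : ∀ i (k : Fin S.N), X i k.castSucc = own (y i) k.succ := fun i k => by simp [hX]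
  have hXl : ∀ i, X i (Fin.last S.N) = xN i := fun i => by simp [hX]
  refine ⟨fun i => ((X i, fun j => X j), U i), fun i => ⟨fun k => ?_, fun k => ?_, fun k => ?_,
    ?_, ?_⟩, fun i k => ?_, fun i j => rfl⟩
  · change S.Coupled i (X i k) (fun j => X j k)
    induction k using Fin.lastCases with
    | last =>
      simp only [hXl]
      exact h4.coupled xN hxNT i
    | cast k =>
      simp only [hXc]
      have h := (hloc i).1 k.succ
      simp only [hcons i] at h
      exact h
  · change X i k ∈ S.X i
    induction k using Fin.lastCases with
    | last =>
      rw [hXl]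
      exact terminal_subset hS h4 i (hxNT i)
    | cast k =>
      rw [hXc]
      exact (hloc i).2.1 k.succ
  · change U i k ∈ S.U i
    simp only [hU]
    split_ifs with h
    · exact (hloc i).2.2.1 _
    · exact h4.input_mem i _ (hT i) _ (hl i)
  · change X i 0 = x' i
    rw [hx', ← hXc]
    rfl
  · change X i (Fin.last S.N) ∈ S.XT i
    rw [hXl]
    exact hxNT i
  · change S.Next i (X i k.castSucc) (U i k) (fun j => X j k.castSucc) (X i k.succ)
    simp only [hXc]
    by_cases h : (k : ℕ) + 1 < S.N
    · have hk : k.succ = (⟨k + 1, h⟩ : Fin S.N).castSucc := rfl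
      have hd := hdyn i ⟨k + 1, h⟩
      simp only [hcons i] at hd
      simp only [hk, hXc, hU, dif_pos h]
      exact hd
    -- Only `k = N - 1` remains: the appended step, governed by the terminal gain.
    · have hk : k.succ = Fin.last S.N := Fin.ext (by simp; omega)
      simp only [hk, hXl, hU, dif_neg h]
      exact ⟨l i, hl i, rfl⟩

/-- Where the state update is unambiguous, the plant follows any admissible update. -/
theorem UnambiguousAt.eq_piece {x : S.State} {u : S.Input} (h : S.UnambiguousAt x u) {i : Fin S.M}
    {xi : Fin (S.n i) → ℝ} (hnext : S.Next i (x i) (u i) (fun j => x j) xi) {l : Fin (S.L i)}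
    (hl : x i ∈ S.P i l) : xi = S.piece i l (x i) (u i) (fun j => x j) := by
  obtain ⟨l', hl', rfl⟩ := hnext
  exact h i l' l hl' hl

/-- The plant may follow another region than the one whose gain was applied; unambiguity identifies
the two updates, so invariance applies. -/
theorem IsClosedLoop.mem_terminalSet_succ (h4 : S.TerminalAssumption) {T : ℕ} {x : ℕ → S.State}
    {v : ℕ → ∀ i, S.InputSeq i} {y : ℕ → S.Var} {u : ℕ → S.Input}
    (hloop : S.IsClosedLoop T x v y u) {t : ℕ} (ht : t < T) (hwell : S.UnambiguousAt (x t) (u t))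
    (hx : x t ∈ S.terminalSet) : x (t + 1) ∈ S.terminalSet := by
  intro i
  obtain ⟨l, hl, hu⟩ := hloop.terminal t ht hx i
  rw [hwell.eq_piece (hloop.plant t ht i) hl, hu]
  exact h4.invariant i _ (hx i) _ (fun j => hx j) l hl

/-- The stored plan predicts the true successor: its first update uses some region containing the
current state, and by unambiguity the plant agrees with that update. -/
theorem IsClosedLoop.mem_feasibleStates_succ (hS : S.Standing) (h1 : S.SwitchingAssumption)
    (h4 : S.TerminalAssumption) (h5 : S.LyapunovAssumption) {T : ℕ} {x : ℕ → S.State}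
    {v : ℕ → ∀ i, S.InputSeq i} {y : ℕ → S.Var} {u : ℕ → S.Input}
    (hloop : S.IsClosedLoop T x v y u) {t : ℕ} (ht : t < T) (hwell : S.UnambiguousAt (x t) (u t))
    (hxT : x t ∉ S.terminalSet) (hx : x t ∈ S.feasibleStates) : x (t + 1) ∈ S.feasibleStates := by
  have hy := (hloop.optimize t ht hxT).mem_feasibleSet hS h1 h4 h5 hx
  refine mem_feasibleStates_of_shift hS h4 hy fun i => ?_
  obtain ⟨hloc, hdyn, hcons⟩ := hy
  have h0 : ∀ i, own (y t i) (Fin.castSucc ⟨0, hS.N_pos⟩) = x t i := fun i => (hloc i).2.2.2.1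
  obtain ⟨l, hl, hstep⟩ := hdyn i ⟨0, hS.N_pos⟩
  simp only [hcons i, h0] at hstep
  rw [h0] at hl
  rw [hstep, hwell.eq_piece (hloop.plant t ht i) hl, hloop.apply_first t ht hxT i hS.N_pos]

/-- The disjunction is the right induction hypothesis: a terminal state remains terminal without any
optimization step, and a nonterminal one must have been feasible. -/
theorem IsClosedLoop.terminal_or_feasible (hS : S.Standing) (h1 : S.SwitchingAssumption)
    (h4 : S.TerminalAssumption) (h5 : S.LyapunovAssumption) {T : ℕ} {x : ℕ → S.State}
    {v : ℕ → ∀ i, S.InputSeq i} {y : ℕ → S.Var} {u : ℕ → S.Input}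
    (hloop : S.IsClosedLoop T x v y u) (hwell : ∀ t < T, S.UnambiguousAt (x t) (u t))
    (hx0 : x 0 ∈ S.feasibleStates) {t : ℕ} (ht : t ≤ T) :
    x t ∈ S.terminalSet ∨ x t ∈ S.feasibleStates := by
  induction t with
  | zero => exact Or.inr hx0
  | succ t ih =>
    by_cases hxT : x t ∈ S.terminalSet
    · exact Or.inl (hloop.mem_terminalSet_succ h4 ht (hwell t ht) hxT)
    · exact Or.inr (hloop.mem_feasibleStates_succ hS h1 h4 h5 ht (hwell t ht) hxT
        ((ih (Nat.le_of_succ_le ht)).resolve_left hxT))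

end PWANetwork

theorem theorem1 (S : PWANetwork) (hS : S.Standing) (h1 : S.SwitchingAssumption)
    (h3 : S.SystemAssumption) (h4 : S.TerminalAssumption) (h5 : S.LyapunovAssumption)
    (T : ℕ) (x : ℕ → S.State) (v : ℕ → ∀ i, S.InputSeq i) (y : ℕ → S.Var) (u : ℕ → S.Input)
    (hx0 : x 0 ∈ S.feasibleStates \ S.terminalSet) (h6 : S.WeaklyFeasible (x 0) (v 0))
    (hloop : S.IsClosedLoop T x v y u) (hwell : ∀ t < T, S.UnambiguousAt (x t) (u t)) :
    ∀ t ≤ T, x t ∉ S.terminalSet →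
      (S.feasibleSet (x t)).Nonempty ∧
      ∀ w ydr s yit z lam, S.IsSwADMM (x t) w ydr s yit z lam →
        ∃ yout, MapClusterPt yout atTop yit := by
  intro t ht hxT
  have hx := (hloop.terminal_or_feasible hS h1 h4 h5 hwell hx0.1 ht).resolve_left hxT
  exact ⟨hx, fun w ydr s yit z lam hadmm =>
    hadmm.exists_mapClusterPt hS h4 h5 (hadmm.feasibleSetOf_nonempty h1 hx)⟩
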